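/- **Setting.** Let $a<b$. Types $\theta\in[a,b]$ are distributed according to an atomless Borel probability measure $F$ on $\mathbb R$ with support $[a,b]$. The cost $C(q,\theta)$ of quality $q\ge 0$ is twice continuously differentiable on $[0,\infty)\times[a,b]$, with $C_q\ge0$, $C_\theta\le0$, $C_{qq}\ge0$, $C_{q\theta}\le0$, $C(0,\theta)=0$ and $C_q(0,\theta)=0$. The welfare weights $\lambda:[a,b]\to\mathbb R$ are nonincreasing with $\int\lambda\,dF=1$. A *quality allocation* is a nondecreasing function $q:[a,b]\to[0,\infty)$. A *rating system* is a signal space $S$ with probability measures $\pi(\cdot\mid x)$ on $S$, measurable in the quality $x$. An *equilibrium* under it consists of a quality allocation $q$ and a measurable price function $p:S\to[0,\infty)$, integrable under every $\pi(\cdot\mid x)$, such that $p(s)=\mathbb E[q\mid s]$ almost surely when $\theta\sim F$ and $s\sim\pi(\cdot\mid q(\theta))$, and such that for every $\theta\in[a,b]$ the profit $\Pi(\theta)=\overline q(\theta)-C(q(\theta),\theta)$, where $\overline q(\theta)=\int_S p\,d\pi(\cdot\mid q(\theta))$ is the *signaled quality*, satisfies $\Pi(\theta)\ge0$ and $\Pi(\theta)\ge\int_S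 p\,d\pi(\cdot\mid x)-C(x,\theta)$ for all $x\ge0$. A quality allocation is *low-quality optimal* if it belongs to an equilibrium, under some rating system, that maximizes $\int\lambda\,\Pi\,dF$ over all equilibria under all rating systems. Write $q\succcurlyeq_F\overline q$ if $\int_a^\theta\overline q\,dF\ge\int_a^\theta q\,dF$ for all $\theta\in[a,b]$, with equality at $\theta=b$. The *relaxed problem* (P) is to maximize $\int\lambda\,\Pi\,dF$ over nondecreasing $q\ge0$ and $\Pi\ge0$ on $[a,b]$ with $\Pi(\theta)=\Pi(a)-\int_a^\theta C_\theta(q(t),t)\,dt$ for all $\theta$ and $\int\Pi\,dF=\int[q-C(q(\theta),\theta)]\,dF$. The *problem with majorization* is to maximize $\int\lambda\,\Pi\,dF$ over nondecreasing $q\ge0$ and nondecreasing $\overline q$ such that $\Pi=\overline q-C(q(\cdot),\cdot)$ is nonnegative and satisfies the same envelope condition, and $q\succcurlyeq_F\overline q$. **Proposition.** 1. A function $q$ is a low-quality-optimal quality allocation if and only if it solves the relaxed problem (P). Likewise, $q$ solves the problem with majorization if and only if it solves (P). 2. Suppose moreover that $C$ is strictly submodular, that is, $C_{q\theta}(q,\theta)<0$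 for all $q>0$ and $\theta\in[a,b]$, and that $\lambda$ is not $F$-almost everywhere equal to $1$. Let $q$ be a low-quality-optimal quality allocation and $\overline q$ the signaled quality in any equilibrium, under any rating system, with quality allocation $q$. Then $q\succcurlyeq_F\overline q$, and majorization is slack in the interior: $$\int_a^\theta\overline q\,dF>\int_a^\theta q\,dF\qquad\text{for all }\theta\in(a,b).$$ Moreover, $(q,\overline q)$ arises in an equilibrium under a *full mixing* rating system: there is a measurable $\alpha:\mathbb R\to[0,1]$ such that each quality $x$ is revealed with probability $\alpha(x)$ and otherwise one generic signal, common to all qualities, is sent; $\alpha(q(\theta))<1$ for every $\theta\in[a,b)$; and the price of the signal that reveals $q(\theta)$ is $q(\theta)$ for every $\theta\in[a,b)$. -/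

import Mathlib

open MeasureTheory ProbabilityTheory Set

noncomputable section

namespace RatingDesign

/-! Throughout, types lie in `[a, b]`, qualities in `[0, ∞)`, `C x t` is the cost of quality `x` for
type `t`, `F` is the law of the type, and `w` is the welfare-weight function. -/

/-- The marginal cost `C_q`. -/
def costQ (C : ℝ → ℝ → ℝ) (x t : ℝ) : ℝ :=
  derivWithin (fun y => C y t) (Ici 0) x

/-- The partial derivative `C_θ`. -/
def costT (a b : ℝ) (C : ℝ → ℝ → ℝ) (x t : ℝ) : ℝ :=
  derivWithin (fun s => C x s) (Icc a b) t

/-- The second partial derivative `C_qq`. -/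
def costQQ (C : ℝ → ℝ → ℝ) (x t : ℝ) : ℝ :=
  derivWithin (fun y => costQ C y t) (Ici 0) x

/-- The mixed partial derivative `C_qθ`. -/
def costQT (a b : ℝ) (C : ℝ → ℝ → ℝ) (x t : ℝ) : ℝ :=
  derivWithin (fun s => costQ C x s) (Icc a b) t

/-- The standing assumptions on the cost function. -/
structure IsCost (a b : ℝ) (C : ℝ → ℝ → ℝ) : Prop where
  smooth : ContDiffOn ℝ 2 (fun z : ℝ × ℝ => C z.1 z.2) (Ici 0 ×ˢ Icc a b)
  costQ_nonneg : ∀ x, 0 ≤ x → ∀ t ∈ Icc a b, 0 ≤ costQ C x t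
  costT_nonpos : ∀ x, 0 ≤ x → ∀ t ∈ Icc a b, costT a b C x t ≤ 0
  costQQ_nonneg : ∀ x, 0 ≤ x → ∀ t ∈ Icc a b, 0 ≤ costQQ C x t
  costQT_nonpos : ∀ x, 0 ≤ x → ∀ t ∈ Icc a b, costQT a b C x t ≤ 0
  cost_zero : ∀ t ∈ Icc a b, C 0 t = 0
  costQ_zero : ∀ t ∈ Icc a b, costQ C 0 t = 0

/-- Strict submodularity: `C_qθ < 0` at every positive quality (at quality `0` the normalization
`C_q(0, θ) = 0` forces `C_qθ = 0`). -/
def IsStrictlySubmodular (a b : ℝ) (C : ℝ → ℝ → ℝ) : Prop :=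
  ∀ x, 0 < x → ∀ t ∈ Icc a b, costQT a b C x t < 0

/-- A quality allocation: a nonnegative, nondecreasing function of the type. -/
def IsQualityAllocation (a b : ℝ) (q : ℝ → ℝ) : Prop :=
  (∀ t ∈ Icc a b, 0 ≤ q t) ∧ MonotoneOn q (Icc a b)

/-- The weighted surplus `∫ w P dF` of a profit function `P`. -/
def welfare (F : Measure ℝ) (w : ℝ → ℝ) (P : ℝ → ℝ) : ℝ :=
  ∫ t, w t * P t ∂F

/-- The profit function of the pair (quality, signaled quality). -/
def profit (C : ℝ → ℝ → ℝ) (q qbar : ℝ → ℝ) (t : ℝ) : ℝ :=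
  qbar t - C (q t) t

/-- The envelope condition `P'(θ) = - C_θ(q(θ), θ)`, in integrated form. -/
def Envelope (a b : ℝ) (C : ℝ → ℝ → ℝ) (q P : ℝ → ℝ) : Prop :=
  ∀ t ∈ Icc a b, P t = P a - ∫ s in a..t, costT a b C (q s) s

/-- `q` `F`-majorizes `qbar`. -/
def Majorizes (a b : ℝ) (F : Measure ℝ) (q qbar : ℝ → ℝ) : Prop :=
  (∀ t ∈ Icc a b, ∫ s in Icc a t, q s ∂F ≤ ∫ s in Icc a t, qbar s ∂F) ∧
    ∫ s in Icc a b, qbar s ∂F = ∫ s in Icc a b, q s ∂F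

/-! ### Rating systems and equilibrium -/

/-- The quality allocation `q` and the prices `p` form an equilibrium under the rating system with
signal space `S` and signal distributions `π x`, and `qbar` is the signaled quality. -/
structure IsEquilibrium (a b : ℝ) (C : ℝ → ℝ → ℝ) (F : Measure ℝ) {S : Type} [MeasurableSpace S]
    (π : Kernel ℝ S) (p : S → ℝ) (q qbar : ℝ → ℝ) : Prop where
  allocation : IsQualityAllocation a b q
  price_measurable : Measurable p
  price_nonneg : ∀ s, 0 ≤ p s
  /-- The expected price of every quality, on path or not, is finite. -/
  price_integrable : ∀ x, 0 ≤ x → Integrable p (π x)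
  /-- `p(s) = 𝔼[q | s]`: this is the defining property of the conditional expectation of the
  quality given the signal, when the type has law `F` and type `t` draws its signal from
  `π (q t)`. -/
  price_eq_condExp : ∀ B : Set S, MeasurableSet B →
    ∫ t, (∫ s in B, p s ∂(π (q t))) ∂F = ∫ t, q t * (π (q t)).real B ∂F
  signaled : ∀ t ∈ Icc a b, qbar t = ∫ s, p s ∂(π (q t))
  incentive : ∀ t ∈ Icc a b, ∀ x, 0 ≤ x → ∫ s, p s ∂(π x) - C x t ≤ profit C q qbar t
  participation : ∀ t ∈ Icc a b, 0 ≤ profit C q qbar t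

/-- The pair (quality, signaled quality) arises in an equilibrium under some rating system. -/
def IsImplementable (a b : ℝ) (C : ℝ → ℝ → ℝ) (F : Measure ℝ) (q qbar : ℝ → ℝ) : Prop :=
  ∃ (S : Type) (_ : MeasurableSpace S) (π : Kernel ℝ S) (_ : IsMarkovKernel π) (p : S → ℝ),
    IsEquilibrium a b C F π p q qbar

/-- `q` is the quality allocation of an equilibrium, under some rating system, that maximizes the
weighted surplus of the sellers among all equilibria under all rating systems. -/
def IsParetoOptimal (a b : ℝ) (C : ℝ → ℝ → ℝ) (F : Measure ℝ) (w : ℝ → ℝ) (q : ℝ → ℝ) : Prop :=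
  ∃ qbar, IsImplementable a b C F q qbar ∧
    ∀ q' qbar', IsImplementable a b C F q' qbar' →
      welfare F w (profit C q' qbar') ≤ welfare F w (profit C q qbar)

/-! ### The design problem with majorization, and the relaxed problem -/

/-- The constraints of the design problem in terms of qualities and signaled qualities:
incentive compatibility, participation and majorization. -/
structure IsMajFeasible (a b : ℝ) (C : ℝ → ℝ → ℝ) (F : Measure ℝ) (q qbar : ℝ → ℝ) : Prop where
  allocation : IsQualityAllocation a b q
  signaled_monotone : MonotoneOn qbar (Icc a b)
  envelope : Envelope a b C q (profit C q qbar)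
  participation : ∀ t ∈ Icc a b, 0 ≤ profit C q qbar t
  majorizes : Majorizes a b F q qbar

/-- `q` solves the design problem with the majorization constraint. -/
def SolvesMaj (a b : ℝ) (C : ℝ → ℝ → ℝ) (F : Measure ℝ) (w : ℝ → ℝ) (q : ℝ → ℝ) : Prop :=
  ∃ qbar, IsMajFeasible a b C F q qbar ∧
    ∀ q' qbar', IsMajFeasible a b C F q' qbar' →
      welfare F w (profit C q' qbar') ≤ welfare F w (profit C q qbar)

/-- The constraints of the relaxed problem. -/
structure IsRelaxedFeasible (a b : ℝ) (C : ℝ → ℝ → ℝ) (F : Measure ℝ) (q P : ℝ → ℝ) : Prop where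
  allocation : IsQualityAllocation a b q
  participation : ∀ t ∈ Icc a b, 0 ≤ P t
  envelope : Envelope a b C q P
  resource : ∫ t, P t ∂F = ∫ t, (q t - C (q t) t) ∂F

/-- `q` solves the relaxed problem. -/
def SolvesRelaxed (a b : ℝ) (C : ℝ → ℝ → ℝ) (F : Measure ℝ) (w : ℝ → ℝ) (q : ℝ → ℝ) : Prop :=
  ∃ P, IsRelaxedFeasible a b C F q P ∧
    ∀ q' P', IsRelaxedFeasible a b C F q' P' → welfare F w P' ≤ welfare F w P

/-! ### Full mixing -/

/-- Signals of a full mixing system: `inl x` reveals the quality `x`, `inr ()` is the generic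
signal. With the quality allocation `q` and prices `p`, the rating system reveals quality `x` with
probability `α x` and otherwise sends the generic signal, the generic signal is sent with positive
probability by every type below the top one, and a revealed quality is priced at itself. -/
def IsFullMixing (a b : ℝ) (π : Kernel ℝ (ℝ ⊕ Unit)) (p : ℝ ⊕ Unit → ℝ) (q : ℝ → ℝ) : Prop :=
  ∃ α : ℝ → ℝ, Measurable α ∧ (∀ x, 0 ≤ α x ∧ α x ≤ 1) ∧
    (∀ x, π x = ENNReal.ofReal (α x) • Measure.dirac (Sum.inl x) +
      ENNReal.ofReal (1 - α x) • Measure.dirac (Sum.inr ())) ∧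
    ∀ t ∈ Ico a b, α (q t) < 1 ∧ p (Sum.inl (q t)) = q t

end RatingDesign

end

/-! The envelope condition and the resource constraint determine profits from `q` alone. By Fubini,
`P a` is `objective` with weight the tail of `1`, and welfare is `objective` with weight the tail of
`1 - w`. So the relaxed problem maximizes one functional of `q` subject to another being
nonnegative, and a change of `q` that raises both is feasible and profitable. Both weights are
nonnegative on `[a, b]`, the second because `1 - w` is nondecreasing with mean zero.

Part 1. Capping quality where marginal cost reaches one raises surplus, and lowers rents because
`C_θ` decreases in quality. Hence solutions of (P) have marginal cost at most one below the top
(`SolvesRelaxed.costQ_le_one`), and every feasible pair is weakly dominated by a capped one. Under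
this bound incentive compatibility makes `q - qbar` nondecreasing on `[a, b)`
(`OnPathIC.monotoneOn_sub`). As its mean is zero, it changes sign at most once, from below. This
gives majorization, and it also yields a price `m` such that `qbar` lies between `q` and `m`, so
that revealing `q` or sending a generic signal priced `m` implements the pair
(`exists_equilibrium_of_mem_uIcc`). The three problems therefore have the same solutions.

Part 2. If majorization binds at an interior type, the monotone gap `q - qbar` vanishes on `(a, b)`.
But a gap that is constant between two interior types forces equal qualities
(`SolvesRelaxed.quality_eq_of_sub_eq`): otherwise average marginal cost is at least one where
quality starts to rise, and lowering qualities there costs little surplus and saves more in rents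
(`SolvesRelaxed.false_of_le_cost_sub`). So `q` would be constant on `(a, b)`, which is not optimal
because raising quality near the top pays (`SolvesRelaxed.not_forall_eq_const`). The same rigidity
makes all types with `q = qbar` share the quality `m`, so they can be sent to the generic signal;
this gives full mixing. -/

namespace RatingDesign

/-! ### One-sided derivatives of the cost and the inequalities they imply. -/

section Calculus

/-- Mean value inequalities for a one-sided differentiable function on a segment. -/
lemma sub_mem_of_hasDerivWithinAt {f f' : ℝ → ℝ} {u v m M : ℝ} (huv : u ≤ v)
    (hf : ∀ x ∈ Icc u v, HasDerivWithinAt f (f' x) (Icc u v) x) :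
    ((∀ x ∈ Icc u v, m ≤ f' x) → m * (v - u) ≤ f v - f u) ∧
      ((∀ x ∈ Icc u v, f' x ≤ M) → f v - f u ≤ M * (v - u)) := by
  have hc : ContinuousOn f (Icc u v) := fun x hx => (hf x hx).continuousWithinAt
  have hd : ∀ x ∈ interior (Icc u v), HasDerivAt f (f' x) x := by
    intro x hx
    exact (hf x (interior_subset hx)).hasDerivAt (mem_interior_iff_mem_nhds.1 hx)
  have hd' : DifferentiableOn ℝ f (interior (Icc u v)) := fun x hx =>
    (hd x hx).differentiableAt.differentiableWithinAt
  refine ⟨fun h => ?_, fun h => ?_⟩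
  · refine (convex_Icc u v).mul_sub_le_image_sub_of_le_deriv hc hd' (fun x hx => ?_) u
      (left_mem_Icc.2 huv) v (right_mem_Icc.2 huv) huv
    rw [(hd x hx).deriv]; exact h x (interior_subset hx)
  · refine (convex_Icc u v).image_sub_le_mul_sub_of_deriv_le hc hd' (fun x hx => ?_) u
      (left_mem_Icc.2 huv) v (right_mem_Icc.2 huv) huv
    rw [(hd x hx).deriv]; exact h x (interior_subset hx)

variable {a b : ℝ}

lemma uniqueDiffOn_prod (hab : a < b) : UniqueDiffOn ℝ (Ici (0 : ℝ) ×ˢ Icc a b) :=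
  (uniqueDiffOn_Ici 0).prod (uniqueDiffOn_Icc hab)

lemma hasDerivWithinAt_fst {g : ℝ → ℝ → ℝ} {x t : ℝ}
    (hg : DifferentiableOn ℝ (fun z : ℝ × ℝ => g z.1 z.2) (Ici 0 ×ˢ Icc a b))
    (hx : 0 ≤ x) (ht : t ∈ Icc a b) :
    HasDerivWithinAt (fun y => g y t)
      (fderivWithin ℝ (fun z : ℝ × ℝ => g z.1 z.2) (Ici 0 ×ˢ Icc a b) (x, t) (1, 0)) (Ici 0) x := by
  have h1 : HasDerivWithinAt (fun y : ℝ => (y, t)) ((1 : ℝ), (0 : ℝ)) (Ici 0) x :=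
    (hasDerivWithinAt_id x _).prodMk (hasDerivWithinAt_const x _ t)
  have h2 : MapsTo (fun y : ℝ => (y, t)) (Ici 0) (Ici 0 ×ˢ Icc a b) := fun y hy => ⟨hy, ht⟩
  exact (hg (x, t) ⟨hx, ht⟩).hasFDerivWithinAt.comp_hasDerivWithinAt x h1 h2

lemma hasDerivWithinAt_snd {g : ℝ → ℝ → ℝ} {x t : ℝ}
    (hg : DifferentiableOn ℝ (fun z : ℝ × ℝ => g z.1 z.2) (Ici 0 ×ˢ Icc a b))
    (hx : 0 ≤ x) (ht : t ∈ Icc a b) :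
    HasDerivWithinAt (fun s => g x s)
      (fderivWithin ℝ (fun z : ℝ × ℝ => g z.1 z.2) (Ici 0 ×ˢ Icc a b) (x, t) (0, 1))
      (Icc a b) t := by
  have h1 : HasDerivWithinAt (fun s : ℝ => (x, s)) ((0 : ℝ), (1 : ℝ)) (Icc a b) t :=
    (hasDerivWithinAt_const t _ x).prodMk (hasDerivWithinAt_id t _)
  have h2 : MapsTo (fun s : ℝ => (x, s)) (Icc a b) (Ici 0 ×ˢ Icc a b) := fun y hy => ⟨hx, hy⟩
  exact (hg (x, t) ⟨hx, ht⟩).hasFDerivWithinAt.comp_hasDerivWithinAt t h1 h2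

variable {C : ℝ → ℝ → ℝ} (hC : IsCost a b C) (hab : a < b)
include hC

lemma IsCost.hasDeriv_q {x t : ℝ} (hx : 0 ≤ x) (ht : t ∈ Icc a b) :
    HasDerivWithinAt (fun y => C y t) (costQ C x t) (Ici 0) x :=
  (hasDerivWithinAt_fst (hC.smooth.differentiableOn (by norm_num)) hx
    ht).differentiableWithinAt.hasDerivWithinAt

lemma IsCost.hasDeriv_t {x t : ℝ} (hx : 0 ≤ x) (ht : t ∈ Icc a b) :
    HasDerivWithinAt (fun s => C x s) (costT a b C x t) (Icc a b) t :=
  (hasDerivWithinAt_snd (hC.smooth.differentiableOn (by norm_num)) hx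
    ht).differentiableWithinAt.hasDerivWithinAt

include hab

lemma IsCost.contDiffOn_fderiv : ContDiffOn ℝ 1
    (fderivWithin ℝ (fun z : ℝ × ℝ => C z.1 z.2) (Ici 0 ×ˢ Icc a b)) (Ici 0 ×ˢ Icc a b) :=
  hC.smooth.fderivWithin (uniqueDiffOn_prod hab) (by norm_num)

lemma IsCost.contDiffOn_costQ :
    ContDiffOn ℝ 1 (fun z : ℝ × ℝ => costQ C z.1 z.2) (Ici 0 ×ˢ Icc a b) := by
  refine ((hC.contDiffOn_fderiv hab).clm_apply
    (contDiffOn_const (c := ((1 : ℝ), (0 : ℝ))))).congr fun z hz => ?_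
  exact (hasDerivWithinAt_fst (hC.smooth.differentiableOn (by norm_num)) hz.1 hz.2).derivWithin
    (uniqueDiffOn_Ici 0 _ hz.1)

lemma IsCost.continuousOn_costT :
    ContinuousOn (fun z : ℝ × ℝ => costT a b C z.1 z.2) (Ici 0 ×ˢ Icc a b) := by
  refine ((hC.contDiffOn_fderiv hab).continuousOn.clm_apply
    (continuousOn_const (c := ((0 : ℝ), (1 : ℝ))))).congr fun z hz => ?_
  exact (hasDerivWithinAt_snd (hC.smooth.differentiableOn (by norm_num)) hz.1 hz.2).derivWithin
    (uniqueDiffOn_Icc hab _ hz.2)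

lemma IsCost.hasDeriv_qq {x t : ℝ} (hx : 0 ≤ x) (ht : t ∈ Icc a b) :
    HasDerivWithinAt (fun y => costQ C y t) (costQQ C x t) (Ici 0) x :=
  (hasDerivWithinAt_fst ((hC.contDiffOn_costQ hab).differentiableOn (by norm_num)) hx
    ht).differentiableWithinAt.hasDerivWithinAt

lemma IsCost.hasDeriv_qt {x t : ℝ} (hx : 0 ≤ x) (ht : t ∈ Icc a b) :
    HasDerivWithinAt (fun s => costQ C x s) (costQT a b C x t) (Icc a b) t :=
  (hasDerivWithinAt_snd ((hC.contDiffOn_costQ hab).differentiableOn (by norm_num)) hx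
    ht).differentiableWithinAt.hasDerivWithinAt

lemma IsCost.continuousOn_costQT :
    ContinuousOn (fun z : ℝ × ℝ => costQT a b C z.1 z.2) (Ici 0 ×ˢ Icc a b) := by
  refine ((((hC.contDiffOn_costQ hab).fderivWithin (m := 0) (uniqueDiffOn_prod hab)
    (by norm_num)).continuousOn).clm_apply
    (continuousOn_const (c := ((0 : ℝ), (1 : ℝ))))).congr fun z hz => ?_
  exact (hasDerivWithinAt_snd ((hC.contDiffOn_costQ hab).differentiableOn (by norm_num))
    hz.1 hz.2).derivWithin (uniqueDiffOn_Icc hab _ hz.2)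

omit hab

lemma IsCost.sub_bounds {x y t m M : ℝ} (hx : 0 ≤ x) (hxy : x ≤ y) (ht : t ∈ Icc a b) :
    ((∀ z ∈ Icc x y, m ≤ costQ C z t) → m * (y - x) ≤ C y t - C x t) ∧
      ((∀ z ∈ Icc x y, costQ C z t ≤ M) → C y t - C x t ≤ M * (y - x)) :=
  sub_mem_of_hasDerivWithinAt (f := fun y => C y t) hxy fun _ hz =>
    (hC.hasDeriv_q (hx.trans hz.1) ht).mono fun _ hw => hx.trans hw.1

lemma IsCost.mono_q {x y t : ℝ} (hx : 0 ≤ x) (hxy : x ≤ y) (ht : t ∈ Icc a b) :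
    C x t ≤ C y t := by
  have := (hC.sub_bounds (m := 0) (M := 0) hx hxy ht).1 fun z hz =>
    hC.costQ_nonneg z (hx.trans hz.1) t ht
  linarith

lemma IsCost.nonneg {x t : ℝ} (hx : 0 ≤ x) (ht : t ∈ Icc a b) : 0 ≤ C x t := by
  rw [← hC.cost_zero t ht]; exact hC.mono_q le_rfl hx ht

include hab

lemma IsCost.costQ_mono {x y t : ℝ} (hx : 0 ≤ x) (hxy : x ≤ y) (ht : t ∈ Icc a b) :
    costQ C x t ≤ costQ C y t := by
  have := (sub_mem_of_hasDerivWithinAt (f := fun y => costQ C y t) (m := 0) (M := 0) hxy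
    fun z hz => (hC.hasDeriv_qq hab (hx.trans hz.1) ht).mono fun _ hw => hx.trans hw.1).1
    fun z hz => hC.costQQ_nonneg z (hx.trans hz.1) t ht
  linarith

lemma IsCost.costQ_sub_bounds {x s t m M : ℝ} (hx : 0 ≤ x) (hs : a ≤ s) (hst : s ≤ t)
    (ht : t ≤ b) :
    ((∀ r ∈ Icc s t, m ≤ costQT a b C x r) → m * (t - s) ≤ costQ C x t - costQ C x s) ∧
      ((∀ r ∈ Icc s t, costQT a b C x r ≤ M) → costQ C x t - costQ C x s ≤ M * (t - s)) :=
  sub_mem_of_hasDerivWithinAt (f := fun r => costQ C x r) hst fun _ hr =>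
    (hC.hasDeriv_qt hab hx ⟨hs.trans hr.1, hr.2.trans ht⟩).mono (Icc_subset_Icc hs ht)

lemma IsCost.costQ_anti {x s t : ℝ} (hx : 0 ≤ x) (hs : a ≤ s) (hst : s ≤ t) (ht : t ≤ b) :
    costQ C x t ≤ costQ C x s := by
  have := (hC.costQ_sub_bounds (m := 0) (M := 0) hab hx hs hst ht).2 fun r hr =>
    hC.costQT_nonpos x hx r ⟨hs.trans hr.1, hr.2.trans ht⟩
  linarith

lemma IsCost.sub_le_costQ_mul {x y t : ℝ} (hx : 0 ≤ x) (hxy : x ≤ y) (ht : t ∈ Icc a b) :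
    C y t - C x t ≤ costQ C y t * (y - x) :=
  (hC.sub_bounds (m := 0) hx hxy ht).2 fun _ hz => hC.costQ_mono hab (hx.trans hz.1) hz.2 ht

lemma IsCost.costQ_mul_le_sub {x y t : ℝ} (hx : 0 ≤ x) (hxy : x ≤ y) (ht : t ∈ Icc a b) :
    costQ C x t * (y - x) ≤ C y t - C x t :=
  (hC.sub_bounds (M := 0) hx hxy ht).1 fun _ hz => hC.costQ_mono hab hx hz.1 ht

/-- A bound on the mixed partial derivative bounds increments of `C_θ` in the quality. -/
lemma IsCost.costT_sub_le {x y t₁ t₂ M t : ℝ} (hx : 0 ≤ x) (hxy : x ≤ y) (h₁ : a ≤ t₁)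
    (h₁₂ : t₁ < t₂) (h₂ : t₂ ≤ b)
    (hM : ∀ z ∈ Icc x y, ∀ s ∈ Icc t₁ t₂, costQT a b C z s ≤ M) (ht : t ∈ Icc t₁ t₂) :
    costT a b C y t - costT a b C x t ≤ M * (y - x) := by
  have hsub : Icc t₁ t₂ ⊆ Icc a b := Icc_subset_Icc h₁ h₂
  have hderiv : HasDerivWithinAt (fun s => M * (y - x) * s - (C y s - C x s))
      (M * (y - x) * 1 - (costT a b C y t - costT a b C x t)) (Icc t₁ t₂) t :=
    ((hasDerivWithinAt_id t _).const_mul _).sub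
      (((hC.hasDeriv_t (hx.trans hxy) (hsub ht)).sub (hC.hasDeriv_t hx (hsub ht))).mono hsub)
  -- No interchange of second derivatives is needed: a mean value bound in `θ` for `C_q`, then one
  -- in `q` for `C`, make this function monotone, and its derivative in `θ` is the claim.
  have hmono : MonotoneOn (fun s => M * (y - x) * s - (C y s - C x s)) (Icc t₁ t₂) := by
    intro s hs s' hs' hss
    have h := (sub_mem_of_hasDerivWithinAt (f := fun z => C z s' - C z s)
      (f' := fun z => costQ C z s' - costQ C z s) (m := 0) (M := M * (s' - s)) hxy
      (fun z hz => (((hC.hasDeriv_q (hx.trans hz.1) (hsub hs')).sub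
        (hC.hasDeriv_q (hx.trans hz.1) (hsub hs))).mono fun _ hw => hx.trans hw.1))).2
      (fun z hz => (hC.costQ_sub_bounds (m := 0) hab (hx.trans hz.1) (hsub hs).1 hss
        (hsub hs').2).2 fun r hr => hM z hz r ⟨hs.1.trans hr.1, hr.2.trans hs'.2⟩)
    dsimp only at h ⊢
    nlinarith
  have := hderiv.nonneg_of_monotoneOn (uniqueDiffWithinAt_iff_accPt.1
    (uniqueDiffOn_Icc h₁₂ t ht)) hmono
  linarith

lemma IsCost.le_costT_sub {x y M t : ℝ} (hx : 0 ≤ x) (hxy : x ≤ y)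
    (hM : ∀ z ∈ Icc x y, ∀ s ∈ Icc a b, -M ≤ costQT a b C z s) (ht : t ∈ Icc a b) :
    -(M * (y - x)) ≤ costT a b C y t - costT a b C x t := by
  have hderiv : HasDerivWithinAt (fun s => (C y s - C x s) + M * (y - x) * s)
      ((costT a b C y t - costT a b C x t) + M * (y - x) * 1) (Icc a b) t :=
    ((hC.hasDeriv_t (hx.trans hxy) ht).sub (hC.hasDeriv_t hx ht)).add
      ((hasDerivWithinAt_id t _).const_mul _)
  have hmono : MonotoneOn (fun s => (C y s - C x s) + M * (y - x) * s) (Icc a b) := by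
    intro s hs s' hs' hss
    have h := (sub_mem_of_hasDerivWithinAt (f := fun z => C z s' - C z s)
      (f' := fun z => costQ C z s' - costQ C z s) (m := -M * (s' - s)) (M := 0) hxy
      (fun z hz => (((hC.hasDeriv_q (hx.trans hz.1) hs').sub
        (hC.hasDeriv_q (hx.trans hz.1) hs)).mono fun _ hw => hx.trans hw.1))).1
      (fun z hz => (hC.costQ_sub_bounds (M := 0) hab (hx.trans hz.1) hs.1 hss
        hs'.2).1 fun r hr => hM z hz r ⟨hs.1.trans hr.1, hr.2.trans hs'.2⟩)
    dsimp only at h ⊢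
    nlinarith
  have := hderiv.nonneg_of_monotoneOn (uniqueDiffWithinAt_iff_accPt.1
    (uniqueDiffOn_Icc hab t ht)) hmono
  linarith

lemma IsCost.costT_anti {x y t : ℝ} (hx : 0 ≤ x) (hxy : x ≤ y) (ht : t ∈ Icc a b) :
    costT a b C y t ≤ costT a b C x t := by
  have := hC.costT_sub_le (M := 0) hab hx hxy le_rfl hab le_rfl
    (fun z hz s hs => hC.costQT_nonpos z (hx.trans hz.1) s hs) ht
  linarith

lemma IsCost.exists_costQT_bound (X : ℝ) : ∃ M, 0 < M ∧
    ∀ x ∈ Icc 0 X, ∀ t ∈ Icc a b, -M ≤ costQT a b C x t := by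
  obtain ⟨M, hM⟩ := (isCompact_Icc.prod isCompact_Icc :
    IsCompact (Icc 0 X ×ˢ Icc a b)).exists_bound_of_continuousOn
    ((hC.continuousOn_costQT hab).mono (prod_mono (fun x hx => hx.1) subset_rfl))
  refine ⟨max M 1, by positivity, fun x hx t ht => ?_⟩
  have := hM (x, t) ⟨hx, ht⟩
  have := (abs_le.1 this).1
  have := le_max_left M 1
  linarith

lemma IsCost.costQ_le_add {X M x s t : ℝ} (hM : ∀ x ∈ Icc 0 X, ∀ t ∈ Icc a b,
    -M ≤ costQT a b C x t) (hx : x ∈ Icc 0 X) (hs : a ≤ s) (hst : s ≤ t) (ht : t ≤ b) :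
    costQ C x s ≤ costQ C x t + M * (t - s) := by
  have := (hC.costQ_sub_bounds (m := -M) (M := 0) hab hx.1 hs hst ht).1 fun r hr =>
    hM x hx r ⟨hs.trans hr.1, hr.2.trans ht⟩
  linarith

lemma IsCost.intervalIntegral_costT {x s t : ℝ} (hx : 0 ≤ x) (hs : a ≤ s) (hst : s ≤ t)
    (ht : t ≤ b) : ∫ r in s..t, costT a b C x r = C x t - C x s := by
  have hc : ContinuousOn (fun r => costT a b C x r) (Icc a b) :=
    (hC.continuousOn_costT hab).comp (f := fun r => (x, r)) (by fun_prop) fun r hr => ⟨hx, hr⟩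
  have hsub : Icc s t ⊆ Icc a b := Icc_subset_Icc hs ht
  refine intervalIntegral.integral_eq_sub_of_hasDerivAt_of_le (f := fun r => C x r) hst
    (fun r hr => ((hC.hasDeriv_t hx (hsub hr)).mono hsub).continuousWithinAt) (fun r hr =>
      (hC.hasDeriv_t hx (hsub (Ioo_subset_Icc_self hr))).hasDerivAt
        (Icc_mem_nhds (hs.trans_lt hr.1) (hr.2.trans_le ht)))
    ((hc.mono hsub).intervalIntegrable_of_Icc hst)

end Calculus

/-! ### Consequences of full support, integrability, and Fubini for rents. -/

section Support

variable {a b : ℝ} {F : Measure ℝ}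

lemma ae_mem_Icc (hF : F.support = Icc a b) : ∀ᵐ t ∂F, t ∈ Icc a b := by
  have : ∀ᵐ t ∂F, t ∈ F.support := Measure.support_mem_ae
  rwa [hF] at this

lemma restrict_Icc_eq_self (hF : F.support = Icc a b) : F.restrict (Icc a b) = F :=
  Measure.restrict_eq_self_of_ae_mem (ae_mem_Icc hF)

lemma measure_Ioo_pos (hF : F.support = Icc a b) {s t : ℝ} (hs : a ≤ s) (hst : s < t)
    (ht : t ≤ b) : 0 < F (Ioo s t) := by
  have : (s + t) / 2 ∈ F.support := by rw [hF]; constructor <;> linarith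
  exact (Measure.mem_support_iff_forall _).1 this _ (Ioo_mem_nhds (by linarith) (by linarith))

lemma measureReal_pos_of_Ioo_subset [IsFiniteMeasure F] (hF : F.support = Icc a b) {s t : ℝ}
    {A : Set ℝ} (hs : a ≤ s) (hst : s < t) (ht : t ≤ b) (hA : Ioo s t ⊆ A) : 0 < F.real A :=
  ENNReal.toReal_pos ((measure_Ioo_pos hF hs hst ht).trans_le (measure_mono hA)).ne'
    (measure_ne_top _ _)

/-- A property that holds almost everywhere holds somewhere in each open subinterval. -/
lemma exists_mem_Ioo_of_ae (hF : F.support = Icc a b) {s t : ℝ} (hs : a ≤ s) (hst : s < t)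
    (ht : t ≤ b) {p : ℝ → Prop} (hp : ∀ᵐ r ∂F, p r) : ∃ r ∈ Ioo s t, p r := by
  by_contra! h
  have h0 : F (Ioo s t) ≤ F {r | ¬ p r} := measure_mono fun r hr => h r hr
  have h1 : F {r | ¬ p r} = 0 := hp
  exact absurd (measure_Ioo_pos hF hs hst ht) (by simp [h1 ▸ h0])

lemma ae_mem_Ico [NullSingletonClass F] (hF : F.support = Icc a b) : ∀ᵐ t ∂F, t ∈ Ico a b := by
  filter_upwards [ae_mem_Icc hF, (measure_singleton b : F {b} = 0) |> compl_mem_ae_iff.2]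
    with t ht hb
  exact ⟨ht.1, lt_of_le_of_ne ht.2 hb⟩

/-- Composition of a kernel continuous on `[0, ∞) × [a, b]` with a quality allocation. -/
lemma integrableOn_comp_allocation {K : ℝ → ℝ → ℝ} (hab : a < b)
    (hK : ContinuousOn (fun z : ℝ × ℝ => K z.1 z.2) (Ici 0 ×ˢ Icc a b)) {q : ℝ → ℝ}
    (hq : IsQualityAllocation a b q) (μ : Measure ℝ) [IsLocallyFiniteMeasure μ] :
    IntegrableOn (fun s => K (q s) s) (Icc a b) μ := by
  -- `q` is controlled only on `[a, b]`; precomposing with the projection onto `[a, b]` makes it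
  -- monotone on the whole line, hence measurable.
  set r : ℝ → ℝ := fun s => max a (min b s) with hr
  have hrm : ∀ s, r s ∈ Icc a b := fun s => ⟨le_max_left _ _, max_le hab.le (min_le_left _ _)⟩
  have hrid : ∀ s ∈ Icc a b, r s = s := fun s hs => by
    simp [hr, min_eq_right hs.2, max_eq_right hs.1]
  have hmono : Monotone (fun s => q (r s)) := fun s s' h =>
    hq.2 (hrm s) (hrm s') (max_le_max le_rfl (min_le_min le_rfl h))
  have hcont : Continuous (fun z : ℝ × ℝ => K (max z.1 0) (r z.2)) := by
    refine hK.comp_continuous (f := fun z : ℝ × ℝ => (max z.1 0, r z.2)) (by fun_prop) fun z =>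
      ⟨mem_Ici.2 (le_max_right _ _), hrm _⟩
  have hmeas : Measurable (fun s => K (max (q (r s)) 0) (r s)) :=
    hcont.measurable.comp (hmono.measurable.prodMk measurable_id)
  have heq : EqOn (fun s => K (max (q (r s)) 0) (r s)) (fun s => K (q s) s) (Icc a b) := by
    intro s hs
    simp [hrid s hs, max_eq_left (hq.1 s hs)]
  obtain ⟨M, hM⟩ := (isCompact_Icc.prod isCompact_Icc :
    IsCompact (Icc 0 (q b) ×ˢ Icc a b)).exists_bound_of_continuousOn
    (hK.mono (prod_mono (fun x hx => hx.1) subset_rfl))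
  have hb : b ∈ Icc a b := right_mem_Icc.2 hab.le
  refine IntegrableOn.congr_fun (f := fun s => K (max (q (r s)) 0) (r s)) ?_ heq measurableSet_Icc
  refine Measure.integrableOn_of_bounded (M := M) isCompact_Icc.measure_lt_top.ne
    hmeas.aestronglyMeasurable ?_
  filter_upwards [ae_restrict_mem measurableSet_Icc] with s hs
  have := hM (q s, s) ⟨⟨hq.1 s hs, hq.2 hs hb hs.2⟩, hs⟩
  have h := heq hs
  dsimp only at h
  rwa [h]

lemma integrable_of_monotoneOn [IsFiniteMeasure F] (hF : F.support = Icc a b)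
    {f : ℝ → ℝ} (hf : MonotoneOn f (Icc a b)) : Integrable f F := by
  have := hf.integrableOn_isCompact (μ := F) isCompact_Icc
  rwa [IntegrableOn, restrict_Icc_eq_self hF] at this

/-- The integral of `u` over the types above `s`. -/
noncomputable def tail (b : ℝ) (F : Measure ℝ) (u : ℝ → ℝ) (s : ℝ) : ℝ := ∫ t in Icc s b, u t ∂F

/-- The rent increment at `s` accrues to every type above `s`, so exchanging the integrals weights
it by the `u`-mass above `s`. -/
lemma integral_tail [IsFiniteMeasure F] (hab : a < b) (hF : F.support = Icc a b) {c u : ℝ → ℝ}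
    (hc : IntegrableOn c (Icc a b)) (hu : Integrable u F) :
    IntegrableOn (fun s => c s * tail b F u s) (Ioc a b) ∧
      ∫ t, u t * (∫ s in a..t, c s) ∂F = ∫ s in a..b, c s * tail b F u s := by
  have hc' : Integrable c (volume.restrict (Ioc a b)) := hc.mono_set Ioc_subset_Icc_self
  have hm : MeasurableSet {z : ℝ × ℝ | z.2 ≤ z.1} := measurableSet_le measurable_snd measurable_fst
  set f : ℝ × ℝ → ℝ := {z : ℝ × ℝ | z.2 ≤ z.1}.indicator (fun z => u z.1 * c z.2) with hf
  have hfi : Integrable f (F.prod (volume.restrict (Ioc a b))) := (hu.mul_prod hc').indicator hm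
  have h1 : ∀ t ∈ Icc a b, ∫ s, f (t, s) ∂(volume.restrict (Ioc a b)) = u t * ∫ s in a..t, c s := by
    intro t ht
    have : (fun s => f (t, s)) = (Iic t).indicator (fun s => u t * c s) := by
      ext s; simp [hf, indicator]
    rw [this, integral_indicator measurableSet_Iic, Measure.restrict_restrict measurableSet_Iic,
      integral_const_mul, intervalIntegral.integral_of_le ht.1]
    congr 3
    ext s; simp only [mem_inter_iff, mem_Iic, mem_Ioc]
    constructor
    · rintro ⟨h, h', -⟩; exact ⟨h', h⟩
    · rintro ⟨h, h'⟩; exact ⟨h', h, h'.trans ht.2⟩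
  have h2 : ∀ s, ∫ t, f (t, s) ∂F = c s * tail b F u s := by
    intro s
    have : (fun t => f (t, s)) = (Ici s).indicator (fun t => c s * u t) := by
      ext t; simp [hf, indicator, mul_comm]
    rw [this, integral_indicator measurableSet_Ici, integral_const_mul, tail]
    congr 1
    refine setIntegral_congr_set ?_
    filter_upwards [ae_mem_Icc hF] with t ht
    simp only [eq_iff_iff]
    exact ⟨fun h => ⟨h, ht.2⟩, fun h => h.1⟩
  constructor
  · have := hfi.integral_prod_right
    simpa only [h2, IntegrableOn] using this
  · rw [intervalIntegral.integral_of_le hab.le]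
    have := integral_integral_swap (f := fun t s => f (t, s)) hfi
    simp only [h2] at this
    rw [← this]
    refine integral_congr_ae ?_
    filter_upwards [ae_mem_Icc hF] with t ht
    exact (h1 t ht).symm

end Support

/-! ### Sign of tail integrals of nondecreasing functions. -/

section Tail

variable {a b : ℝ} {F : Measure ℝ} [IsProbabilityMeasure F] {u : ℝ → ℝ}

omit [IsProbabilityMeasure F] in
lemma tail_split (hu : Integrable u F) {s t : ℝ} (hst : s ≤ t) (ht : t ≤ b) :
    tail b F u s = (∫ r in Ico s t, u r ∂F) + tail b F u t := by
  rw [tail, tail, ← Ico_union_Icc_eq_Icc hst ht,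
    setIntegral_union _ measurableSet_Icc hu.integrableOn hu.integrableOn]
  exact disjoint_left.2 fun x hx hx' => absurd hx.2 (not_lt.2 hx'.1)

omit [IsProbabilityMeasure F] in
lemma tail_left (hF : F.support = Icc a b) : tail b F u a = ∫ t, u t ∂F := by
  rw [tail, restrict_Icc_eq_self hF]

omit [IsProbabilityMeasure F] in
lemma tail_right [NullSingletonClass F] : tail b F u b = 0 := by
  rw [tail, Icc_self, setIntegral_measure_zero _ (measure_singleton b)]

omit [IsProbabilityMeasure F] in
/-- Tail integrals of a nondecreasing function are quasi-concave. -/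
lemma min_tail_le (hu : MonotoneOn u (Icc a b)) (hui : Integrable u F) {s₀ s s₁ : ℝ} (h0 : a ≤ s₀)
    (h1 : s₀ ≤ s) (h2 : s ≤ s₁) (h3 : s₁ ≤ b) :
    min (tail b F u s₀) (tail b F u s₁) ≤ tail b F u s := by
  have hs : s ∈ Icc a b := ⟨h0.trans h1, h2.trans h3⟩
  rcases le_total 0 (u s) with h | h
  · refine (min_le_right _ _).trans ?_
    rw [tail_split hui h2 h3]
    have : 0 ≤ ∫ r in Ico s s₁, u r ∂F := setIntegral_nonneg measurableSet_Ico fun r hr =>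
      h.trans (hu hs ⟨hs.1.trans hr.1, hr.2.le.trans h3⟩ hr.1)
    linarith
  · refine (min_le_left _ _).trans ?_
    rw [tail_split hui h1 hs.2]
    have : ∫ r in Ico s₀ s, u r ∂F ≤ 0 := setIntegral_nonpos measurableSet_Ico fun r hr =>
      (hu ⟨h0.trans hr.1, hr.2.le.trans hs.2⟩ hs hr.2.le).trans h
    linarith

/-- Quasi-concavity reduces the claim to the endpoints, where the tail is `∫ u` and `0`. -/
lemma tail_nonneg [NullSingletonClass F] (hF : F.support = Icc a b)
    (hu : MonotoneOn u (Icc a b)) (hu0 : 0 ≤ ∫ t, u t ∂F) {s : ℝ} (hs : s ∈ Icc a b) :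
    0 ≤ tail b F u s := by
  have h := min_tail_le hu (integrable_of_monotoneOn hF hu) le_rfl hs.1 hs.2 le_rfl
  rw [tail_right, tail_left hF, min_eq_right hu0] at h
  exact h

/-- Suppose the tail vanishes at `s`. If `u s < 0`, the part below `s` has positive mass and makes
the total negative. If `u s ≥ 0`, then `u` vanishes a.e. above `s`, so `u s = 0` and `u ≤ 0` below
`s`, where nonnegativity of the total forces `u = 0` a.e. -/
lemma tail_pos [NullSingletonClass F] (hF : F.support = Icc a b)
    (hu : MonotoneOn u (Icc a b)) (hu0 : 0 ≤ ∫ t, u t ∂F) (hne : ¬ ∀ᵐ t ∂F, u t = 0) {s : ℝ}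
    (hs : s ∈ Ioo a b) : 0 < tail b F u s := by
  have hui := integrable_of_monotoneOn hF hu
  have hs' := Ioo_subset_Icc_self hs
  refine lt_of_le_of_ne (tail_nonneg hF hu hu0 hs') fun h => hne ?_
  have hI : ∫ t, u t ∂F = (∫ r in Ico a s, u r ∂F) + tail b F u s := by
    rw [← tail_left hF, tail_split hui hs.1.le hs.2.le]
  have hrest : ∀ t ∈ Icc a b, t ∈ Ico a s ∨ t ∈ Icc s b := fun t ht =>
    (lt_or_ge t s).imp (fun h => ⟨ht.1, h⟩) (fun h => ⟨h, ht.2⟩)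
  rcases lt_or_ge (u s) 0 with hneg | hpos
  · exfalso
    have : ∫ r in Ico a s, u r ∂F ≤ ∫ r in Ico a s, u s ∂F :=
      setIntegral_mono_on hui.integrableOn (integrable_const _) measurableSet_Ico
        fun r hr => hu ⟨hr.1, hr.2.le.trans hs'.2⟩ hs' hr.2.le
    rw [setIntegral_const, smul_eq_mul] at this
    have hp := measureReal_pos_of_Ioo_subset hF le_rfl hs.1 hs.2.le
      (Ioo_subset_Ico_self (a := a) (b := s))
    nlinarith
  · have hup : ∀ t ∈ Icc s b, 0 ≤ u t := fun t ht =>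
      hpos.trans (hu hs' ⟨hs'.1.trans ht.1, ht.2⟩ ht.1)
    have hz : u =ᵐ[F.restrict (Icc s b)] 0 :=
      (setIntegral_eq_zero_iff_of_nonneg_ae ((ae_restrict_mem measurableSet_Icc).mono hup)
        hui.integrableOn).1 h.symm
    have hz' := (ae_restrict_iff' measurableSet_Icc).1 hz
    have hus : u s = 0 := by
      obtain ⟨r, hr, hr'⟩ := exists_mem_Ioo_of_ae hF hs.1.le hs.2 le_rfl hz'
      have h0 : u r = 0 := hr' (Ioo_subset_Icc_self hr)
      exact le_antisymm (h0 ▸ hu hs' ⟨hs'.1.trans hr.1.le, hr.2.le⟩ hr.1.le) hpos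
    have hlow : ∀ t ∈ Ico a s, u t ≤ 0 := fun t ht =>
      hus ▸ hu ⟨ht.1, ht.2.le.trans hs'.2⟩ hs' ht.2.le
    have hlow0 : ∫ r in Ico a s, -u r ∂F = 0 := by
      have h1 := setIntegral_nonpos measurableSet_Ico hlow (μ := F)
      rw [integral_neg]
      linarith
    have hz2 : (fun r => -u r) =ᵐ[F.restrict (Ico a s)] 0 :=
      (setIntegral_eq_zero_iff_of_nonneg_ae ((ae_restrict_mem measurableSet_Ico).mono
        fun t ht => neg_nonneg.2 (hlow t ht)) hui.neg.integrableOn).1 hlow0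
    have hz2' := (ae_restrict_iff' measurableSet_Ico).1 hz2
    filter_upwards [ae_mem_Icc hF, hz', hz2'] with t ht h1 h2
    rcases hrest t ht with h | h
    · simpa using h2 h
    · exact h1 h

lemma tail_le_mul {K : ℝ} (hu : Integrable u F) {s : ℝ} (h : ∀ t ∈ Icc s b, u t ≤ K) :
    tail b F u s ≤ K * F.real (Icc s b) := by
  have : tail b F u s ≤ ∫ r in Icc s b, K ∂F :=
    setIntegral_mono_on hu.integrableOn (integrable_const _) measurableSet_Icc h
  rwa [setIntegral_const, smul_eq_mul, mul_comm] at this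

end Tail

/-! ### The relaxed problem as a problem in the quality allocation alone. -/

section Objective

variable {a b : ℝ} {C : ℝ → ℝ → ℝ} {F : Measure ℝ} {w : ℝ → ℝ}

/-- Expected surplus less the rents `-C_θ` weighted by `g`. -/
noncomputable def objective (a b : ℝ) (C : ℝ → ℝ → ℝ) (F : Measure ℝ) (g q : ℝ → ℝ) : ℝ :=
  ∫ t, (q t - C (q t) t) ∂F + ∫ s in a..b, costT a b C (q s) s * g s

variable (hC : IsCost a b C) (hab : a < b) [IsProbabilityMeasure F] (hF : F.support = Icc a b)
include hC hab

lemma IsCost.integrableOn_costT {q : ℝ → ℝ} (hq : IsQualityAllocation a b q) :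
    IntegrableOn (fun s => costT a b C (q s) s) (Icc a b) :=
  integrableOn_comp_allocation (K := costT a b C) hab (hC.continuousOn_costT hab) hq _

include hF

lemma IsCost.integrable_cost {q : ℝ → ℝ} (hq : IsQualityAllocation a b q) :
    Integrable (fun t => C (q t) t) F := by
  have := integrableOn_comp_allocation (K := C) hab hC.smooth.continuousOn hq F
  rwa [IntegrableOn, restrict_Icc_eq_self hF] at this

lemma IsCost.integrable_surplus {q : ℝ → ℝ} (hq : IsQualityAllocation a b q) :
    Integrable (fun t => q t - C (q t) t) F :=
  (integrable_of_monotoneOn hF hq.2).sub (hC.integrable_cost hab hF hq)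

/-- Integrate the envelope formula against `u` and apply `integral_tail`. The choice `u = 1`
determines `P a`, and `u = w` then gives welfare. -/
lemma IsRelaxedFeasible.weighted_integral {q P u : ℝ → ℝ} (h : IsRelaxedFeasible a b C F q P)
    (hu : Integrable u F) : ∫ t, u t * P t ∂F =
      P a * ∫ t, u t ∂F - ∫ s in a..b, costT a b C (q s) s * tail b F u s := by
  have hc := hC.integrableOn_costT hab h.allocation
  rw [← (integral_tail hab hF hc hu).2, ← integral_const_mul]
  have hb : ∃ B, ∀ t ∈ Icc a b, ‖∫ s in a..t, costT a b C (q s) s‖ ≤ B :=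
    isCompact_Icc.exists_bound_of_continuousOn
      (intervalIntegral.continuousOn_primitive_interval (by rwa [uIcc_of_le hab.le])
        |>.mono (by rw [uIcc_of_le hab.le]))
  have hcont : ContinuousOn (fun t => ∫ s in a..t, costT a b C (q s) s) (Icc a b) :=
    intervalIntegral.continuousOn_primitive_interval (by rwa [uIcc_of_le hab.le])
        |>.mono (by rw [uIcc_of_le hab.le])
  obtain ⟨B, hB⟩ := hb
  have hint : Integrable (fun t => u t * ∫ s in a..t, costT a b C (q s) s) F := by
    refine hu.mul_bdd (c := B) ?_ ?_
    · have := hcont.aestronglyMeasurable (μ := F) measurableSet_Icc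
      rwa [restrict_Icc_eq_self hF] at this
    · filter_upwards [ae_mem_Icc hF] with t ht using hB t ht
  rw [← integral_sub (hu.const_mul _) hint]
  refine integral_congr_ae ?_
  filter_upwards [ae_mem_Icc hF] with t ht
  rw [h.envelope t ht]; ring

/-- In the relaxed problem the profit of the lowest type is determined by the qualities. -/
lemma IsRelaxedFeasible.profit_left {q P : ℝ → ℝ} (h : IsRelaxedFeasible a b C F q P) :
    P a = objective a b C F (tail b F fun _ => 1) q := by
  have := h.weighted_integral hC hab hF (integrable_const 1)
  simp only [one_mul, h.resource, integral_const, probReal_univ, smul_eq_mul, mul_one] at this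
  rw [objective]; linarith

lemma IsRelaxedFeasible.welfare_eq {q P : ℝ → ℝ} (h : IsRelaxedFeasible a b C F q P)
    (hw : Integrable w F) (hw1 : ∫ t, w t ∂F = 1) :
    welfare F w P = objective a b C F (tail b F fun t => 1 - w t) q := by
  have h1 := h.weighted_integral hC hab hF (integrable_const 1)
  have h2 := h.weighted_integral hC hab hF hw
  simp only [one_mul, h.resource, integral_const, probReal_univ, smul_eq_mul, mul_one] at h1
  have hc := hC.integrableOn_costT hab h.allocation
  have h3 := (integral_tail hab hF hc (integrable_const 1)).1
  have h4 := (integral_tail hab hF hc hw).1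
  have h5 : ∫ s in a..b, costT a b C (q s) s * tail b F (fun t => 1 - w t) s =
      (∫ s in a..b, costT a b C (q s) s * tail b F (fun _ => 1) s) -
        ∫ s in a..b, costT a b C (q s) s * tail b F w s := by
    rw [← intervalIntegral.integral_sub]
    · refine intervalIntegral.integral_congr fun s _ => ?_
      simp only [tail]
      rw [integral_sub (integrable_const _) hw.integrableOn, mul_sub]
    · exact (intervalIntegrable_iff_integrableOn_Ioc_of_le hab.le).2 h3
    · exact (intervalIntegrable_iff_integrableOn_Ioc_of_le hab.le).2 h4
  rw [welfare, h2, hw1, objective, h5]; linarith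

/-- Participation binds only at `a`, since `C_θ ≤ 0` makes profits nondecreasing. Defining `P` by
the envelope formula from the value of `P a` that balances resources leaves one scalar constraint.
-/
lemma exists_isRelaxedFeasible {q : ℝ → ℝ} (hq : IsQualityAllocation a b q)
    (h0 : 0 ≤ objective a b C F (tail b F fun _ => 1) q) :
    ∃ P, IsRelaxedFeasible a b C F q P := by
  have hc := hC.integrableOn_costT hab hq
  have hI := (integral_tail hab hF hc (integrable_const (1 : ℝ))).2
  simp only [one_mul] at hI
  have hcont : ContinuousOn (fun t => ∫ s in a..t, costT a b C (q s) s) (Icc a b) :=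
    intervalIntegral.continuousOn_primitive_interval (by rwa [uIcc_of_le hab.le])
        |>.mono (by rw [uIcc_of_le hab.le])
  have hint : Integrable (fun t => ∫ s in a..t, costT a b C (q s) s) F := by
    have := hcont.integrableOn_compact (μ := F) isCompact_Icc
    rwa [IntegrableOn, restrict_Icc_eq_self hF] at this
  refine ⟨fun t => objective a b C F (tail b F fun _ => 1) q - ∫ s in a..t, costT a b C (q s) s,
    hq, fun t ht => ?_, fun t ht => ?_, ?_⟩
  · have : ∫ s in a..t, costT a b C (q s) s ≤ 0 := by
      rw [intervalIntegral.integral_of_le ht.1]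
      refine setIntegral_nonpos measurableSet_Ioc fun s hs => ?_
      have hs' : s ∈ Icc a b := ⟨hs.1.le, hs.2.trans ht.2⟩
      exact hC.costT_nonpos _ (hq.1 s hs') s hs'
    linarith
  · simp
  · rw [integral_sub (integrable_const _) hint, hI]
    simp [objective]

/-- Lower bounds on the pointwise gains bound the gain in the objective. -/
lemma add_le_objective_sub {q q' u A B : ℝ → ℝ} (hq : IsQualityAllocation a b q)
    (hq' : IsQualityAllocation a b q') (hu : Integrable u F) (hA : Integrable A F)
    (hB : IntegrableOn B (Ioc a b))
    (hAle : ∀ᵐ t ∂F, t ∈ Icc a b → A t ≤ (q' t - C (q' t) t) - (q t - C (q t) t))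
    (hBle : ∀ᵐ s, s ∈ Icc a b →
      B s ≤ (costT a b C (q' s) s - costT a b C (q s) s) * tail b F u s) :
    ∫ t, A t ∂F + ∫ s in Ioc a b, B s ≤
      objective a b C F (tail b F u) q' - objective a b C F (tail b F u) q := by
  have hi := (integral_tail hab hF (hC.integrableOn_costT hab hq) hu).1
  have hi' := (integral_tail hab hF (hC.integrableOn_costT hab hq') hu).1
  have h1 : ∫ t, A t ∂F ≤ ∫ t, ((q' t - C (q' t) t) - (q t - C (q t) t)) ∂F := by
    refine integral_mono_ae hA ((hC.integrable_surplus hab hF hq').sub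
      (hC.integrable_surplus hab hF hq)) ?_
    filter_upwards [hAle, ae_mem_Icc hF] with t h ht using h ht
  have h2 : ∫ s in Ioc a b, B s ≤ ∫ s in Ioc a b, (costT a b C (q' s) s * tail b F u s -
      costT a b C (q s) s * tail b F u s) := by
    refine integral_mono_ae hB (hi'.sub hi) ?_
    filter_upwards [ae_restrict_mem measurableSet_Ioc, ae_restrict_of_ae hBle] with s hs h
    have := h (Ioc_subset_Icc_self hs)
    linarith
  rw [integral_sub (hC.integrable_surplus hab hF hq') (hC.integrable_surplus hab hF hq)] at h1
  rw [integral_sub hi' hi] at h2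
  simp only [objective, intervalIntegral.integral_of_le hab.le]
  linarith

end Objective

/-! ### Monotonicity from estimates on short intervals. -/

section LocalToGlobal

/-- A uniformly locally nondecreasing function is nondecreasing. -/
lemma monotoneOn_of_local {f : ℝ → ℝ} {I : Set ℝ} [I.OrdConnected] {δ : ℝ} (hδ : 0 < δ)
    (h : ∀ s ∈ I, ∀ s' ∈ I, s ≤ s' → s' - s ≤ δ → f s ≤ f s') : MonotoneOn f I := by
  have key : ∀ n : ℕ, ∀ s ∈ I, ∀ s' ∈ I, s ≤ s' → s' - s ≤ n * δ → f s ≤ f s' := by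
    intro n
    induction n with
    | zero =>
      intro s _ s' _ hss h0
      have : s = s' := by simp at h0; linarith
      rw [this]
    | succ n ih =>
      intro s hs s' hs' hss hn
      rcases le_total (s' - s) δ with hd | hd
      · exact h s hs s' hs' hss hd
      · push_cast at hn
        have hm : s + δ ∈ I := OrdConnected.out' hs hs' ⟨by linarith, by linarith⟩
        exact (h s hs _ hm (by linarith) (by linarith)).trans
          (ih _ hm s' hs' (by linarith) (by linarith))
  intro s hs s' hs' hss
  obtain ⟨n, hn⟩ := exists_nat_ge ((s' - s) / δ)
  exact key n s hs s' hs' hss ((div_le_iff₀ hδ).1 hn)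

lemma nonpos_of_forall_pos_le_mul {x K : ℝ} (h : ∀ ε > 0, x ≤ ε * K) : x ≤ 0 := by
  by_contra! hx
  have hK : 0 < |K| + 1 := by positivity
  have := h (x / 2 / (|K| + 1)) (by positivity)
  have h2 : x / 2 / (|K| + 1) * K ≤ x / 2 / (|K| + 1) * (|K| + 1) :=
    mul_le_mul_of_nonneg_left ((le_abs_self K).trans (by linarith)) (by positivity)
  rw [div_mul_cancel₀ _ hK.ne'] at h2
  linarith

/-- An error bounded by an increment of `g` telescopes: `f + ε g` is nondecreasing for every `ε >
0`. Used with `g = q`, this replaces any regularity of the allocation. -/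
lemma monotoneOn_of_local_approx {f g : ℝ → ℝ} {I : Set ℝ} [I.OrdConnected]
    (h : ∀ ε > 0, ∃ δ > 0, ∀ s ∈ I, ∀ s' ∈ I, s ≤ s' → s' - s ≤ δ →
      f s - f s' ≤ ε * (g s' - g s)) : MonotoneOn f I := by
  intro s hs s' hs' hss
  have := nonpos_of_forall_pos_le_mul (x := f s - f s') (K := g s' - g s) fun ε hε => by
    obtain ⟨δ, hδ, hd⟩ := h ε hε
    have hm : MonotoneOn (fun r => f r + ε * g r) I := monotoneOn_of_local hδ
      fun r hr r' hr' h1 h2 => by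
        have := hd r hr r' hr' h1 h2
        linarith
    have := hm hs hs' hss
    dsimp only at this
    linarith
  linarith

end LocalToGlobal

/-! ### Incentive compatibility, the envelope condition, and the gap `q - qbar`. -/

section IncentiveCompatibility

variable {a b : ℝ} {C : ℝ → ℝ → ℝ} {q qbar : ℝ → ℝ}

/-- No type gains by mimicking the quality of another type. -/
def OnPathIC (a b : ℝ) (C : ℝ → ℝ → ℝ) (q qbar : ℝ → ℝ) : Prop :=
  ∀ t ∈ Icc a b, ∀ t' ∈ Icc a b, qbar t' - C (q t') t ≤ profit C q qbar t

variable (hC : IsCost a b C) (hab : a < b) (hq : IsQualityAllocation a b q)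
include hC

lemma signaled_nonneg (hq : IsQualityAllocation a b q) (hp : ∀ t ∈ Icc a b, 0 ≤ profit C q qbar t)
    {t : ℝ} (ht : t ∈ Icc a b) : 0 ≤ qbar t := by
  have h1 := hp t ht
  have h2 := hC.nonneg (hq.1 t ht) ht
  rw [profit] at h1
  linarith

include hq

lemma OnPathIC.signaled_mono (h : OnPathIC a b C q qbar) : MonotoneOn qbar (Icc a b) := by
  intro t ht t' ht' htt
  have h1 := h t' ht' t ht
  have h2 := hC.mono_q (hq.1 t ht) (hq.2 ht ht' htt) ht'
  rw [profit] at h1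
  linarith

omit hC hq in
lemma OnPathIC.signaled_eq (h : OnPathIC a b C q qbar) {t t' : ℝ} (ht : t ∈ Icc a b)
    (ht' : t' ∈ Icc a b) (hqq : q t = q t') : qbar t = qbar t' := by
  have h1 := h t ht t' ht'
  have h2 := h t' ht' t ht
  rw [profit, hqq] at h1
  rw [profit, hqq] at h2
  linarith

include hab

omit hab in
lemma OnPathIC.signaled_monoOn_quality (h : OnPathIC a b C q qbar) {t t' : ℝ} (ht : t ∈ Icc a b)
    (ht' : t' ∈ Icc a b) (hqq : q t ≤ q t') : qbar t ≤ qbar t' := by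
  rcases le_total t t' with h' | h'
  · exact h.signaled_mono hC hq ht ht' h'
  · exact (h.signaled_eq ht ht' (le_antisymm hqq (hq.2 ht' ht h'))).le

/-- The two mutual incentive constraints of nearby types enclose the profit increment between
integrals of `C_θ` with quality frozen at either end. Freezing costs at most a product of increments
of `q` and of the type, which disappears under refinement, even at jumps of `q`. -/
lemma OnPathIC.envelope (h : OnPathIC a b C q qbar) : Envelope a b C q (profit C q qbar) := by
  set P := profit C q qbar with hP
  set c : ℝ → ℝ := fun s => costT a b C (q s) s with hc
  have hb : b ∈ Icc a b := right_mem_Icc.2 hab.le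
  have ha : a ∈ Icc a b := left_mem_Icc.2 hab.le
  have hci : ∀ s ∈ Icc a b, ∀ s' ∈ Icc a b, s ≤ s' → IntervalIntegrable c volume s s' := by
    intro s hs s' hs' hss
    rw [intervalIntegrable_iff_integrableOn_Ioc_of_le hss]
    exact (hC.integrableOn_costT hab hq).mono_set fun r hr => ⟨hs.1.trans hr.1.le, hr.2.trans hs'.2⟩
  have hki : ∀ x, 0 ≤ x → ∀ s ∈ Icc a b, ∀ s' ∈ Icc a b, s ≤ s' →
      IntervalIntegrable (fun r => costT a b C x r) volume s s' := by
    intro x hx s hs s' hs' hss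
    refine ContinuousOn.intervalIntegrable_of_Icc hss ?_
    exact (hC.continuousOn_costT hab).comp (f := fun r => (x, r)) (by fun_prop)
      fun r hr => ⟨hx, hs.1.trans hr.1, hr.2.trans hs'.2⟩
  obtain ⟨M, hM0, hM⟩ := hC.exists_costQT_bound hab (q b)
  set E : ℝ → ℝ := fun s => P s + ∫ r in a..s, c r with hE
  have hEsub : ∀ s ∈ Icc a b, ∀ s' ∈ Icc a b, s ≤ s' →
      E s' - E s = P s' - P s + ∫ r in s..s', c r := by
    intro s hs s' hs' hss
    have := intervalIntegral.integral_add_adjacent_intervals (hci a ha s hs hs.1)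
      (hci s hs s' hs' hss)
    simp only [hE]; linarith
  have hbound : ∀ s ∈ Icc a b, ∀ s' ∈ Icc a b, s ≤ s' →
      |E s' - E s| ≤ M * (q s' - q s) * (s' - s) := by
    intro s hs s' hs' hss
    rw [hEsub s hs s' hs' hss]
    have h1 := h s' hs' s hs
    have h2 := h s hs s' hs'
    have e1 := hC.intervalIntegral_costT hab (hq.1 s hs) hs.1 hss hs'.2
    have e2 := hC.intervalIntegral_costT hab (hq.1 s' hs') hs.1 hss hs'.2
    have hqq := hq.2 hs hs' hss
    have i1 : ∫ r in s..s', costT a b C (q s) r ≤ ∫ r in s..s', (c r + M * (q s' - q s)) := by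
      refine intervalIntegral.integral_mono_on hss (hki _ (hq.1 s hs) s hs s' hs' hss)
        ((hci s hs s' hs' hss).add intervalIntegrable_const) fun r hr => ?_
      have hr' : r ∈ Icc a b := ⟨hs.1.trans hr.1, hr.2.trans hs'.2⟩
      have h3 := hC.le_costT_sub hab (hq.1 s hs) (hq.2 hs hr' hr.1) (fun z hz => hM z
        ⟨(hq.1 s hs).trans hz.1, hz.2.trans (hq.2 hr' hb hr'.2)⟩) hr'
      have h4 := hq.2 hr' hs' hr.2
      simp only [hc]
      nlinarith
    have i2 : ∫ r in s..s', c r ≤ ∫ r in s..s', (costT a b C (q s') r + M * (q s' - q s)) := by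
      refine intervalIntegral.integral_mono_on hss (hci s hs s' hs' hss)
        ((hki _ (hq.1 s' hs') s hs s' hs' hss).add intervalIntegrable_const) fun r hr => ?_
      have hr' : r ∈ Icc a b := ⟨hs.1.trans hr.1, hr.2.trans hs'.2⟩
      have h3 := hC.le_costT_sub hab (hq.1 r hr') (hq.2 hr' hs' hr.2) (fun z hz => hM z
        ⟨(hq.1 r hr').trans hz.1, hz.2.trans (hq.2 hs' hb hs'.2)⟩) hr'
      have h4 := hq.2 hs hr' hr.1
      simp only [hc]
      nlinarith
    rw [intervalIntegral.integral_add (hci s hs s' hs' hss) intervalIntegrable_const,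
      intervalIntegral.integral_const, smul_eq_mul, e1] at i1
    rw [intervalIntegral.integral_add (hki _ (hq.1 s' hs') s hs s' hs' hss)
      intervalIntegrable_const, intervalIntegral.integral_const, smul_eq_mul, e2] at i2
    have d1 : P s = qbar s - C (q s) s := rfl
    have d2 : P s' = qbar s' - C (q s') s' := rfl
    rw [abs_le]
    constructor <;> linarith
  -- Taking `σ = 1` and `σ = -1` shows that `E` is constant.
  have hmono : ∀ σ : ℝ, |σ| = 1 → MonotoneOn (fun s => σ * E s) (Icc a b) := by
    intro σ hσ
    refine monotoneOn_of_local_approx (g := q) fun ε hε => ⟨ε / M, by positivity, ?_⟩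
    intro s hs s' hs' hss hd
    have h1 := hbound s hs s' hs' hss
    have hqq := hq.2 hs hs' hss
    rw [le_div_iff₀ hM0] at hd
    calc σ * E s - σ * E s' = σ * (E s - E s') := by ring
      _ ≤ |σ * (E s - E s')| := le_abs_self _
      _ = |E s' - E s| := by rw [abs_mul, hσ, one_mul, abs_sub_comm]
      _ ≤ M * (q s' - q s) * (s' - s) := h1
      _ = ((s' - s) * M) * (q s' - q s) := by ring
      _ ≤ ε * (q s' - q s) := mul_le_mul_of_nonneg_right hd (by linarith)
  intro t ht
  have h1 := hmono 1 (by simp) ha ht ht.1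
  have h2 := hmono (-1) (by simp) ha ht ht.1
  have h3 : E a = P a := by simp [hE]
  have h4 : E t = P t + ∫ r in a..t, c r := rfl
  dsimp only at h1 h2
  rw [h3, h4] at h1 h2
  linarith

/-- Submodularity compares the true rent between `t` and `t'` with the rent at the fixed quality `q
t'`: as `q` is nondecreasing, the sign favours truth-telling whichever type is higher. -/
lemma onPathIC_of_envelope (h : Envelope a b C q (profit C q qbar)) : OnPathIC a b C q qbar := by
  set P := profit C q qbar with hP
  set c : ℝ → ℝ := fun s => costT a b C (q s) s with hc
  have ha : a ∈ Icc a b := left_mem_Icc.2 hab.le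
  have hci : ∀ s ∈ Icc a b, ∀ s' ∈ Icc a b, s ≤ s' → IntervalIntegrable c volume s s' := by
    intro s hs s' hs' hss
    rw [intervalIntegrable_iff_integrableOn_Ioc_of_le hss]
    exact (hC.integrableOn_costT hab hq).mono_set fun r hr => ⟨hs.1.trans hr.1.le, hr.2.trans hs'.2⟩
  have hki : ∀ x, 0 ≤ x → ∀ s ∈ Icc a b, ∀ s' ∈ Icc a b, s ≤ s' →
      IntervalIntegrable (fun r => costT a b C x r) volume s s' := by
    intro x hx s hs s' hs' hss
    refine ContinuousOn.intervalIntegrable_of_Icc hss ?_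
    exact (hC.continuousOn_costT hab).comp (f := fun r => (x, r)) (by fun_prop)
      fun r hr => ⟨hx, hs.1.trans hr.1, hr.2.trans hs'.2⟩
  have hsub : ∀ s ∈ Icc a b, ∀ s' ∈ Icc a b, s ≤ s' → P s' - P s = - ∫ r in s..s', c r := by
    intro s hs s' hs' hss
    have h1 := intervalIntegral.integral_add_adjacent_intervals (hci a ha s hs hs.1)
      (hci s hs s' hs' hss)
    have h2 := h s hs
    have h3 := h s' hs'
    simp only [hc] at h1 ⊢
    linarith
  intro t ht t' ht'
  have d1 : P t' = qbar t' - C (q t') t' := rfl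
  rcases le_total t t' with htt | htt
  · have e := hC.intervalIntegral_costT hab (hq.1 t' ht') ht.1 htt ht'.2
    have i : ∫ r in t..t', costT a b C (q t') r ≤ ∫ r in t..t', c r := by
      refine intervalIntegral.integral_mono_on htt (hki _ (hq.1 t' ht') t ht t' ht' htt)
        (hci t ht t' ht' htt) fun r hr => ?_
      have hr' : r ∈ Icc a b := ⟨ht.1.trans hr.1, hr.2.trans ht'.2⟩
      exact hC.costT_anti hab (hq.1 r hr') (hq.2 hr' ht' hr.2) hr'
    have := hsub t ht t' ht' htt
    linarith
  · have e := hC.intervalIntegral_costT hab (hq.1 t' ht') ht'.1 htt ht.2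
    have i : ∫ r in t'..t, c r ≤ ∫ r in t'..t, costT a b C (q t') r := by
      refine intervalIntegral.integral_mono_on htt (hci t' ht' t ht htt)
        (hki _ (hq.1 t' ht') t' ht' t ht htt) fun r hr => ?_
      have hr' : r ∈ Icc a b := ⟨ht'.1.trans hr.1, hr.2.trans ht.2⟩
      exact hC.costT_anti hab (hq.1 t' ht') (hq.2 ht' hr' hr.1) hr'
    have := hsub t' ht' t ht htt
    linarith

/-- If marginal costs are at most one, qualities increase faster than signaled qualities. -/
lemma OnPathIC.monotoneOn_sub (h : OnPathIC a b C q qbar)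
    (hle : ∀ t ∈ Ico a b, costQ C (q t) t ≤ 1) :
    MonotoneOn (fun t => q t - qbar t) (Ico a b) := by
  obtain ⟨M, hM0, hM⟩ := hC.exists_costQT_bound hab (q b)
  refine monotoneOn_of_local_approx (g := q) fun ε hε => ⟨ε / M, by positivity, ?_⟩
  intro s hs s' hs' hss hd
  have hsI := Ico_subset_Icc_self hs
  have hsI' := Ico_subset_Icc_self hs'
  have hqq := hq.2 hsI hsI' hss
  rw [le_div_iff₀ hM0] at hd
  -- Type `s` must not mimic `s'`, which involves the marginal cost of type `s` at `q s'`; the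
  -- assumed bound is for type `s'`, and moving to the nearby type `s` costs at most `ε`.
  have h1 := h s hsI s' hsI'
  have h2 := hC.sub_le_costQ_mul hab (hq.1 s hsI) hqq hsI
  have h3 := hC.costQ_le_add hab hM (x := q s')
    ⟨hq.1 s' hsI', hq.2 hsI' (right_mem_Icc.2 hab.le) hsI'.2⟩ hs.1 hss hsI'.2
  have h4 := hle s' hs'
  have h5 : costQ C (q s') s * (q s' - q s) ≤ (1 + ε) * (q s' - q s) :=
    mul_le_mul_of_nonneg_right (by linarith) (by linarith)
  rw [profit] at h1
  linarith

end IncentiveCompatibility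

/-! ### From equilibria and majorization to relaxed feasibility, and majorization from a monotone
gap. -/

section Feasibility

variable {a b : ℝ} {C : ℝ → ℝ → ℝ} {F : Measure ℝ} [IsProbabilityMeasure F] {q qbar : ℝ → ℝ}

omit [IsProbabilityMeasure F] in
-- A nondecreasing gap with mean zero is nonpositive, then nonnegative, so its partial integrals
-- from the left are nonpositive. The type `b`, where monotonicity may fail, is null.
lemma majorizes_of_monotoneOn_sub [NullSingletonClass F] (hab : a < b) (hF : F.support = Icc a b)
    (hqi : Integrable q F) (hqbi : Integrable qbar F)
    (hD : MonotoneOn (fun t => q t - qbar t) (Ico a b)) (hint : ∫ t, qbar t ∂F = ∫ t, q t ∂F) :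
    Majorizes a b F q qbar := by
  refine ⟨fun t ht => ?_, by rw [restrict_Icc_eq_self hF, hint]⟩
  rcases eq_or_lt_of_le ht.2 with rfl | htb
  · rw [restrict_Icc_eq_self hF, hint]
  have hsum : ∀ f : ℝ → ℝ, Integrable f F →
      ∫ s, f s ∂F = (∫ s in Icc a t, f s ∂F) + ∫ s in (Icc a t)ᶜ, f s ∂F := fun f hf =>
    (integral_add_compl measurableSet_Icc hf).symm
  have hdi := hqi.sub hqbi
  have htot : ∫ s, (q s - qbar s) ∂F = 0 := by rw [integral_sub hqi hqbi, hint, sub_self]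
  have hsp := hsum _ hdi
  simp only [Pi.sub_apply] at hsp
  rw [htot] at hsp
  have htI : t ∈ Ico a b := ⟨ht.1, htb⟩
  have hsplit : ∫ s in Icc a t, (q s - qbar s) ∂F =
      (∫ s in Icc a t, q s ∂F) - ∫ s in Icc a t, qbar s ∂F :=
    integral_sub hqi.integrableOn hqbi.integrableOn
  suffices hgoal : ∫ s in Icc a t, (q s - qbar s) ∂F ≤ 0 by linarith
  rcases le_total (q t - qbar t) 0 with h | h
  · exact setIntegral_nonpos measurableSet_Icc fun s hs =>
      (hD ⟨hs.1, hs.2.trans_lt htb⟩ htI hs.2).trans h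
  · have : 0 ≤ ∫ s in (Icc a t)ᶜ, (q s - qbar s) ∂F := by
      refine setIntegral_nonneg_of_ae_restrict ?_
      filter_upwards [ae_restrict_mem measurableSet_Icc.compl, ae_restrict_of_ae (ae_mem_Ico hF)]
        with s hs hs'
      have hts : t ≤ s := by
        by_contra! hlt
        exact hs ⟨hs'.1, hlt.le⟩
      exact h.trans (hD htI hs' hts)
    linarith

variable (hC : IsCost a b C) (hab : a < b) (hF : F.support = Icc a b)
include hC hab hF

lemma isRelaxedFeasible_profit (hq : IsQualityAllocation a b q) (hqb : MonotoneOn qbar (Icc a b))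
    (hp : ∀ t ∈ Icc a b, 0 ≤ profit C q qbar t) (he : Envelope a b C q (profit C q qbar))
    (hint : ∫ t, qbar t ∂F = ∫ t, q t ∂F) :
    IsRelaxedFeasible a b C F q (profit C q qbar) := by
  refine ⟨hq, hp, he, ?_⟩
  have hc := hC.integrable_cost hab hF hq
  simp only [profit]
  rw [integral_sub (integrable_of_monotoneOn hF hqb) hc,
    integral_sub (integrable_of_monotoneOn hF hq.2) hc, hint]

lemma IsMajFeasible.isRelaxedFeasible (h : IsMajFeasible a b C F q qbar) :
    IsRelaxedFeasible a b C F q (profit C q qbar) := by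
  refine isRelaxedFeasible_profit hC hab hF h.allocation h.signaled_monotone h.participation
    h.envelope ?_
  have := h.majorizes.2
  rwa [restrict_Icc_eq_self hF] at this

omit [IsProbabilityMeasure F] hC hab hF in
lemma IsEquilibrium.onPathIC {S : Type} [MeasurableSpace S] {π : Kernel ℝ S} {p : S → ℝ}
    (h : IsEquilibrium a b C F π p q qbar) : OnPathIC a b C q qbar := by
  intro t ht t' ht'
  rw [h.signaled t' ht']
  exact h.incentive t ht _ (h.allocation.1 t' ht')

omit [IsProbabilityMeasure F] hC hab in
lemma IsEquilibrium.integral_signaled {S : Type} [MeasurableSpace S] {π : Kernel ℝ S}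
    [IsMarkovKernel π] {p : S → ℝ} (h : IsEquilibrium a b C F π p q qbar) :
    ∫ t, qbar t ∂F = ∫ t, q t ∂F := by
  have := h.price_eq_condExp univ MeasurableSet.univ
  simp only [Measure.restrict_univ, probReal_univ, mul_one] at this
  rw [← this]
  refine integral_congr_ae ?_
  filter_upwards [ae_mem_Icc hF] with t ht using h.signaled t ht

lemma IsEquilibrium.isRelaxedFeasible {S : Type} [MeasurableSpace S] {π : Kernel ℝ S}
    [IsMarkovKernel π] {p : S → ℝ} (h : IsEquilibrium a b C F π p q qbar) :
    IsRelaxedFeasible a b C F q (profit C q qbar) :=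
  isRelaxedFeasible_profit hC hab hF h.allocation (h.onPathIC.signaled_mono hC h.allocation)
    h.participation (h.onPathIC.envelope hC hab h.allocation) (h.integral_signaled hF)

end Feasibility

/-! ### Capping qualities where marginal cost reaches one. -/

section Ceiling

variable {a b : ℝ} {C : ℝ → ℝ → ℝ} {q : ℝ → ℝ}

/-- The quality lowered, where necessary, to the largest one with marginal cost at most one. -/
noncomputable def ceilingQuality (C : ℝ → ℝ → ℝ) (q : ℝ → ℝ) (t : ℝ) : ℝ :=
  sSup {x ∈ Icc 0 (q t) | costQ C x t ≤ 1}

variable (hC : IsCost a b C) (hab : a < b) (hq : IsQualityAllocation a b q)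
include hC hab hq

lemma ceilingQuality_mem {t : ℝ} (ht : t ∈ Icc a b) :
    ceilingQuality C q t ∈ {x ∈ Icc 0 (q t) | costQ C x t ≤ 1} := by
  have hcont : ContinuousOn (fun x => costQ C x t) (Icc 0 (q t)) := fun x hx =>
    ((hC.hasDeriv_qq hab hx.1 ht).continuousWithinAt).mono fun y hy => hy.1
  refine IsClosed.csSup_mem (hcont.preimage_isClosed_of_isClosed isClosed_Icc isClosed_Iic) ?_
    ⟨q t, fun x hx => hx.1.2⟩
  exact ⟨0, ⟨le_rfl, hq.1 t ht⟩, by simp [hC.costQ_zero t ht]⟩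

lemma costQ_gt_of_ceilingQuality_lt {x t : ℝ} (ht : t ∈ Icc a b) (hx : ceilingQuality C q t < x)
    (hxq : x ≤ q t) : 1 < costQ C x t := by
  by_contra! h
  exact absurd hx (not_lt.2 (le_csSup ⟨q t, fun y hy => hy.1.2⟩
    ⟨⟨((ceilingQuality_mem hC hab hq ht).1.1).trans hx.le, hxq⟩, h⟩))

/-- A quality admissible for `t` stays admissible for higher types, because marginal cost decreases
in the type. -/
lemma isQualityAllocation_ceilingQuality : IsQualityAllocation a b (ceilingQuality C q) := by
  refine ⟨fun t ht => (ceilingQuality_mem hC hab hq ht).1.1, fun t ht t' ht' htt => ?_⟩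
  obtain ⟨⟨h0, h1⟩, h2⟩ := ceilingQuality_mem hC hab hq ht
  exact le_csSup ⟨q t', fun y hy => hy.1.2⟩
    ⟨⟨h0, h1.trans (hq.2 ht ht' htt)⟩, (hC.costQ_anti hab h0 ht.1 htt ht'.2).trans h2⟩

lemma surplus_lt_ceilingQuality {t : ℝ} (ht : t ∈ Icc a b) (hlt : ceilingQuality C q t < q t) :
    q t - C (q t) t < ceilingQuality C q t - C (ceilingQuality C q t) t := by
  have h0 := (ceilingQuality_mem hC hab hq ht).1.1
  set z := ceilingQuality C q t with hz
  have hz1 : 1 ≤ costQ C z t := by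
    have hc : ContinuousWithinAt (fun x => costQ C x t) (Ioi z) z :=
      (hC.hasDeriv_qq hab h0 ht).continuousWithinAt.mono fun y hy => h0.trans (mem_Ioi.1 hy).le
    refine ge_of_tendsto hc ?_
    filter_upwards [Ioc_mem_nhdsGT hlt] with x hx
    exact (costQ_gt_of_ceilingQuality_lt hC hab hq ht hx.1 hx.2).le
  have hm1 : z < (z + q t) / 2 := by linarith
  have hm2 : (z + q t) / 2 < q t := by linarith
  have e1 := hC.costQ_mul_le_sub hab h0 hm1.le ht
  have e2 := hC.costQ_mul_le_sub hab (h0.trans hm1.le) hm2.le ht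
  have e3 := costQ_gt_of_ceilingQuality_lt hC hab hq ht hm1 hm2.le
  nlinarith

lemma surplus_le_ceilingQuality {t : ℝ} (ht : t ∈ Icc a b) :
    q t - C (q t) t ≤ ceilingQuality C q t - C (ceilingQuality C q t) t := by
  rcases eq_or_lt_of_le (ceilingQuality_mem hC hab hq ht).1.2 with h | h
  · rw [h]
  · exact (surplus_lt_ceilingQuality hC hab hq ht h).le

/-- Under nonnegative tails the saved rents only help, so the gain is at least the gain in surplus.
-/
lemma objective_ceilingQuality {F : Measure ℝ} [IsProbabilityMeasure F] (hF : F.support = Icc a b)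
    {u : ℝ → ℝ} (hu : Integrable u F) (hu0 : ∀ s ∈ Icc a b, 0 ≤ tail b F u s) :
    ∫ t, ((ceilingQuality C q t - C (ceilingQuality C q t) t) - (q t - C (q t) t)) ∂F ≤
      objective a b C F (tail b F u) (ceilingQuality C q) - objective a b C F (tail b F u) q := by
  have hq' := isQualityAllocation_ceilingQuality hC hab hq
  have := add_le_objective_sub hC hab hF hq hq' hu (B := fun _ => 0)
    ((hC.integrable_surplus hab hF hq').sub (hC.integrable_surplus hab hF hq))
    integrableOn_zero (ae_of_all _ fun t _ => le_rfl) (ae_of_all _ fun s hs => ?_)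
  · simpa using this
  · have hm := (ceilingQuality_mem hC hab hq hs).1
    exact mul_nonneg (sub_nonneg.2 (hC.costT_anti hab hm.1 hm.2 hs)) (hu0 s hs)

end Ceiling

/-! ### Marginal costs at solutions of the relaxed problem. -/

section Optimality

variable {a b : ℝ} {C : ℝ → ℝ → ℝ} {F : Measure ℝ} [IsProbabilityMeasure F] {w q : ℝ → ℝ}
variable (hC : IsCost a b C) (hab : a < b) (hF : F.support = Icc a b)
  (hw : AntitoneOn w (Icc a b)) (hw1 : ∫ t, w t ∂F = 1)
include hF hw

omit [IsProbabilityMeasure F] in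
lemma integrable_weight [IsFiniteMeasure F] : Integrable w F := by
  simpa using (integrable_of_monotoneOn (F := F) hF hw.neg).neg

omit hF [IsProbabilityMeasure F] in
lemma monotoneOn_one_sub_weight : MonotoneOn (fun t => 1 - w t) (Icc a b) :=
  fun _ ht _ ht' htt => sub_le_sub_left (hw ht ht' htt) 1

include hw1

lemma integral_one_sub_weight : ∫ t, (1 - w t) ∂F = 0 := by
  rw [integral_sub (integrable_const _) (integrable_weight hF hw), hw1]
  simp

lemma tail_one_sub_weight_nonneg [NullSingletonClass F] {s : ℝ} (hs : s ∈ Icc a b) :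
    0 ≤ tail b F (fun t => 1 - w t) s :=
  tail_nonneg hF (monotoneOn_one_sub_weight hw) (integral_one_sub_weight hF hw hw1).ge hs

omit hw hw1 hF [IsProbabilityMeasure F] in
lemma tail_one_eq [IsFiniteMeasure F] (s : ℝ) : tail b F (fun _ => 1) s = F.real (Icc s b) := by
  simp [tail]

include hC hab

/-- The hypothesis on the unweighted objective keeps `P' a ≥ 0`. Every perturbation argument ends by
contradicting this lemma or by extracting an equality from it. -/
lemma SolvesRelaxed.objective_le (h : SolvesRelaxed a b C F w q) {q' : ℝ → ℝ}
    (hq' : IsQualityAllocation a b q')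
    (h1 : objective a b C F (tail b F fun _ => 1) q ≤ objective a b C F (tail b F fun _ => 1) q') :
    objective a b C F (tail b F fun t => 1 - w t) q' ≤
      objective a b C F (tail b F fun t => 1 - w t) q := by
  obtain ⟨P, hP, hopt⟩ := h
  have hwi := integrable_weight hF hw
  have h0 := hP.participation a (left_mem_Icc.2 hab.le)
  rw [hP.profit_left hC hab hF] at h0
  obtain ⟨P', hP'⟩ := exists_isRelaxedFeasible hC hab hF hq' (h0.trans h1)
  rw [← hP.welfare_eq hC hab hF hwi hw1, ← hP'.welfare_eq hC hab hF hwi hw1]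
  exact hopt q' P' hP'

/-- Lowering qualities to the ceiling raises welfare in the relaxed problem. -/
lemma IsRelaxedFeasible.exists_ceilingQuality [NullSingletonClass F] {P : ℝ → ℝ}
    (h : IsRelaxedFeasible a b C F q P) :
    ∃ P', IsRelaxedFeasible a b C F (ceilingQuality C q) P' ∧ welfare F w P ≤ welfare F w P' := by
  have hwi := integrable_weight hF hw
  have hq := h.allocation
  have hq' := isQualityAllocation_ceilingQuality hC hab hq
  have hpos : 0 ≤ ∫ t, ((ceilingQuality C q t - C (ceilingQuality C q t) t) -
      (q t - C (q t) t)) ∂F := by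
    refine integral_nonneg_of_ae ?_
    filter_upwards [ae_mem_Icc hF] with t ht
    exact sub_nonneg.2 (surplus_le_ceilingQuality hC hab hq ht)
  have h1 := objective_ceilingQuality hC hab hq hF (integrable_const 1)
    fun s _ => (tail_one_eq (F := F) s).symm ▸ measureReal_nonneg
  have h2 := objective_ceilingQuality hC hab hq hF ((integrable_const 1).sub hwi)
    fun s hs => tail_one_sub_weight_nonneg hF hw hw1 hs
  have h0 := h.participation a (left_mem_Icc.2 hab.le)
  rw [h.profit_left hC hab hF] at h0
  obtain ⟨P', hP'⟩ := exists_isRelaxedFeasible hC hab hF hq' (by linarith)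
  refine ⟨P', hP', ?_⟩
  rw [h.welfare_eq hC hab hF hwi hw1, hP'.welfare_eq hC hab hF hwi hw1]
  simp only [Pi.sub_def] at h2
  linarith

/-- At a solution of the relaxed problem marginal costs are at most one below the top. -/
lemma SolvesRelaxed.costQ_le_one [NullSingletonClass F] (h : SolvesRelaxed a b C F w q) {t : ℝ}
    (ht : t ∈ Ico a b) : costQ C (q t) t ≤ 1 := by
  have hwi := integrable_weight hF hw
  have hq : IsQualityAllocation a b q := h.choose_spec.1.allocation
  have hq' := isQualityAllocation_ceilingQuality hC hab hq
  have hnn : 0 ≤ᵐ[F] fun t => (ceilingQuality C q t - C (ceilingQuality C q t) t) -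
      (q t - C (q t) t) := by
    filter_upwards [ae_mem_Icc hF] with t ht
    exact sub_nonneg.2 (surplus_le_ceilingQuality hC hab hq ht)
  have hpos := integral_nonneg_of_ae hnn
  have h1 := objective_ceilingQuality hC hab hq hF (integrable_const 1)
    fun s _ => (tail_one_eq (F := F) s).symm ▸ measureReal_nonneg
  have h2 := objective_ceilingQuality hC hab hq hF ((integrable_const 1).sub hwi)
    fun s hs => tail_one_sub_weight_nonneg hF hw hw1 hs
  have h3 := h.objective_le hC hab hF hw hw1 hq' (by linarith)
  simp only [Pi.sub_def] at h2
  -- Optimality leaves no room for a surplus gain, so the cap is inactive almost everywhere.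
  have hz := (integral_eq_zero_iff_of_nonneg_ae hnn ((hC.integrable_surplus hab hF hq').sub
    (hC.integrable_surplus hab hF hq))).1 (by linarith)
  have hae : ∀ᵐ s ∂F, s ∈ Icc a b ∧ costQ C (q s) s ≤ 1 := by
    filter_upwards [ae_mem_Icc hF, hz] with s hs hs0
    refine ⟨hs, ?_⟩
    have hm := ceilingQuality_mem hC hab hq hs
    rcases eq_or_lt_of_le hm.1.2 with he | hlt
    · rw [← he]; exact hm.2
    · have := surplus_lt_ceilingQuality hC hab hq hs hlt
      simp only [Pi.zero_apply] at hs0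
      linarith
  have htI := Ico_subset_Icc_self ht
  obtain ⟨M, hM0, hM⟩ := hC.exists_costQT_bound hab (q b)
  refine le_of_forall_pos_le_add fun ε hε => ?_
  -- The a.e. bound reaches every `t < b` through a slightly higher type: its quality is no lower,
  -- and `C_q` falls by at most `M` per unit of type. No such type exists at `b`.
  have hlt : t < min b (t + ε / M) := lt_min ht.2 (by have := div_pos hε hM0; linarith)
  obtain ⟨s, hs, hsI, hs1⟩ := exists_mem_Ioo_of_ae hF ht.1 hlt (min_le_left _ _) hae
  have hsM : (s - t) * M ≤ ε := by
    rw [← le_div_iff₀ hM0]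
    have := hs.2.trans_le (min_le_right _ _)
    linarith
  have h4 := hC.costQ_le_add hab hM (x := q t)
    ⟨hq.1 t htI, hq.2 htI (right_mem_Icc.2 hab.le) htI.2⟩ ht.1 hs.1.le hsI.2
  have h5 := hC.costQ_mono hab (hq.1 t htI) (hq.2 htI hsI hs.1.le) hsI
  linarith

end Optimality

/-! ### The kernel of a full mixing rating system. -/

section MixKernel

/-- The rating system that reveals quality `x` with probability `α x` and otherwise sends the
generic signal. -/
noncomputable def mixKernel (α : ℝ → ℝ) (hα : Measurable α) : Kernel ℝ (ℝ ⊕ Unit) where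
  toFun x := ENNReal.ofReal (α x) • Measure.dirac (Sum.inl x) +
    ENNReal.ofReal (1 - α x) • Measure.dirac (Sum.inr ())
  measurable' := by
    refine Measure.measurable_of_measurable_coe _ fun B hB => ?_
    simp only [Measure.coe_add, Measure.coe_smul, Pi.add_apply, Pi.smul_apply,
      Measure.dirac_apply' _ hB, smul_eq_mul]
    have h1 : Measurable fun x : ℝ => B.indicator (1 : ℝ ⊕ Unit → ENNReal) (Sum.inl x) :=
      (measurable_one.indicator hB).comp measurable_inl
    exact (hα.ennreal_ofReal.mul h1).add (((measurable_const.sub hα).ennreal_ofReal).mul_const _)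

variable {α : ℝ → ℝ} (hα : Measurable α)

lemma mixKernel_apply (x : ℝ) : mixKernel α hα x =
    ENNReal.ofReal (α x) • Measure.dirac (Sum.inl x) +
      ENNReal.ofReal (1 - α x) • Measure.dirac (Sum.inr ()) := rfl

variable (h01 : ∀ x, 0 ≤ α x ∧ α x ≤ 1)
include h01

lemma isMarkovKernel_mixKernel : IsMarkovKernel (mixKernel α hα) := by
  refine ⟨fun x => ⟨?_⟩⟩
  rw [mixKernel_apply]
  simp only [Measure.coe_add, Measure.coe_smul, Pi.add_apply, Pi.smul_apply, measure_univ,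
    smul_eq_mul, mul_one]
  rw [← ENNReal.ofReal_add (h01 x).1 (sub_nonneg.2 (h01 x).2)]
  simp

omit h01 in
lemma integrable_mixKernel {f : ℝ ⊕ Unit → ℝ} (hf : Measurable f) (x : ℝ) :
    Integrable f (mixKernel α hα x) := by
  rw [mixKernel_apply]
  refine Integrable.add_measure (Integrable.smul_measure ?_ ENNReal.ofReal_ne_top)
    (Integrable.smul_measure ?_ ENNReal.ofReal_ne_top)
  · exact integrable_dirac' hf.stronglyMeasurable (by simp)
  · exact integrable_dirac' hf.stronglyMeasurable (by simp)

lemma integral_mixKernel {f : ℝ ⊕ Unit → ℝ} (hf : Measurable f) (x : ℝ) :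
    ∫ s, f s ∂(mixKernel α hα x) = α x * f (Sum.inl x) + (1 - α x) * f (Sum.inr ()) := by
  have i1 : Integrable f (Measure.dirac (Sum.inl x)) :=
    integrable_dirac' hf.stronglyMeasurable (by simp)
  have i2 : Integrable f (Measure.dirac (Sum.inr ())) :=
    integrable_dirac' hf.stronglyMeasurable (by simp)
  rw [mixKernel_apply, integral_add_measure (i1.smul_measure ENNReal.ofReal_ne_top)
    (i2.smul_measure ENNReal.ofReal_ne_top), integral_smul_measure, integral_smul_measure,
    integral_dirac' _ _ hf.stronglyMeasurable, integral_dirac' _ _ hf.stronglyMeasurable,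
    ENNReal.toReal_ofReal (h01 x).1, ENNReal.toReal_ofReal (sub_nonneg.2 (h01 x).2)]
  simp

lemma setIntegral_mixKernel {f : ℝ ⊕ Unit → ℝ} (hf : Measurable f) {B : Set (ℝ ⊕ Unit)}
    (hB : MeasurableSet B) (x : ℝ) :
    ∫ s in B, f s ∂(mixKernel α hα x) =
      α x * B.indicator f (Sum.inl x) + (1 - α x) * B.indicator f (Sum.inr ()) := by
  rw [← integral_indicator hB, integral_mixKernel hα h01 (hf.indicator hB)]

lemma mixKernel_real {B : Set (ℝ ⊕ Unit)} (hB : MeasurableSet B) (x : ℝ) :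
    (mixKernel α hα x).real B =
      α x * B.indicator 1 (Sum.inl x) + (1 - α x) * B.indicator 1 (Sum.inr ()) := by
  rw [← integral_indicator_one hB, integral_mixKernel hα h01 (measurable_one.indicator hB)]

end MixKernel

/-! ### Implementation by full mixing. -/

section Implementation

variable {a b : ℝ} {C : ℝ → ℝ → ℝ} {q qbar : ℝ → ℝ}

/-- The signaled quality of the best type that produces at most quality `x`. -/
noncomputable def signaledExtension (a b : ℝ) (q qbar : ℝ → ℝ) (x : ℝ) : ℝ :=
  sSup (qbar '' {t ∈ Icc a b | q t ≤ x})

variable (hC : IsCost a b C) (hab : a < b) (hq : IsQualityAllocation a b q)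
  (hic : OnPathIC a b C q qbar) (hp : ∀ t ∈ Icc a b, 0 ≤ profit C q qbar t)
include hC hq hic

lemma signaledExtension_eq {t : ℝ} (ht : t ∈ Icc a b) :
    signaledExtension a b q qbar (q t) = qbar t := by
  refine IsGreatest.csSup_eq ⟨⟨t, ⟨ht, le_rfl⟩, rfl⟩, ?_⟩
  rintro _ ⟨s, ⟨hs, hsq⟩, rfl⟩
  exact hic.signaled_monoOn_quality hC hq hs ht hsq

include hp

lemma monotone_signaledExtension (hab : a < b) : Monotone (signaledExtension a b q qbar) := by
  intro x y hxy
  rcases (qbar '' {t ∈ Icc a b | q t ≤ x}).eq_empty_or_nonempty with h | h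
  -- Below every produced quality the supremum is over the empty set and equals `0`, which is still
  -- a lower bound for the signaled qualities.
  · rw [signaledExtension, h, Real.sSup_empty]
    refine Real.sSup_nonneg ?_
    rintro _ ⟨s, ⟨hs, -⟩, rfl⟩
    exact signaled_nonneg hC hq hp hs
  · refine csSup_le_csSup ⟨qbar b, ?_⟩ h (image_mono fun t ht => ⟨ht.1, ht.2.trans hxy⟩)
    rintro _ ⟨s, ⟨hs, -⟩, rfl⟩
    exact hic.signaled_mono hC hq hs (right_mem_Icc.2 hab.le) hs.2

/-- Producing `x` is no better than mimicking some type with quality at most `x`, whose quality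
costs no more; with no such type, revenue is `0` and participation suffices. -/
lemma signaledExtension_sub_le {x t : ℝ} (hx : 0 ≤ x) (ht : t ∈ Icc a b) :
    signaledExtension a b q qbar x - C x t ≤ profit C q qbar t := by
  rw [sub_le_iff_le_add]
  refine Real.sSup_le ?_ (add_nonneg (hp t ht) (hC.nonneg hx ht))
  rintro _ ⟨s, ⟨hs, hsq⟩, rfl⟩
  have h1 := hic t ht s hs
  have h2 := hC.mono_q (hq.1 s hs) hsq ht
  linarith

include hab

/-- Full mixing with generic price `m` implements a pair whose signaled quality lies between the
quality and `m`. -/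
theorem exists_equilibrium_of_mem_uIcc {F : Measure ℝ} [IsProbabilityMeasure F]
    [NullSingletonClass F] (hF : F.support = Icc a b) {m : ℝ} (hm0 : 0 ≤ m)
    (hm : ∀ t ∈ Ico a b, qbar t ∈ uIcc (q t) m) (hint : ∫ t, qbar t ∂F = ∫ t, q t ∂F) :
    ∃ (π : Kernel ℝ (ℝ ⊕ Unit)) (_ : IsMarkovKernel π) (p : ℝ ⊕ Unit → ℝ),
      IsEquilibrium a b C F π p q qbar ∧
      ((∀ t ∈ Ico a b, qbar t = q t → q t = m) → IsFullMixing a b π p q) := by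
  classical
  set Q := signaledExtension a b q qbar with hQ
  have hQm : Measurable Q := (monotone_signaledExtension hC hq hic hp hab).measurable
  -- Qualities at which mixing can deliver `Q x`. The quality `q b` is left out when only the top
  -- type produces it, since `qbar b` need not lie between `q b` and `m`.
  set E : Set ℝ := {x | Q x ∈ uIcc x m} ∩ {x | x = q b → ∃ t ∈ Ico a b, q t = q b} with hE
  have hEm : MeasurableSet E := by
    have h1 : MeasurableSet {x | Q x ∈ uIcc x m} := by
      simp only [uIcc, mem_Icc]
      exact (measurableSet_le (measurable_id.min measurable_const) hQm).inter
        (measurableSet_le hQm (measurable_id.max measurable_const))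
    refine h1.inter ?_
    by_cases hex : ∃ t ∈ Ico a b, q t = q b
    · have : {x | x = q b → ∃ t ∈ Ico a b, q t = q b} = univ := eq_univ_of_forall fun _ _ => hex
      rw [this]; exact MeasurableSet.univ
    · have : {x | x = q b → ∃ t ∈ Ico a b, q t = q b} = {q b}ᶜ := by
        ext x; exact ⟨fun h hx => hex (h hx), fun h hx => absurd hx h⟩
      rw [this]; exact (measurableSet_singleton _).compl
  -- On `E`, `α` solves `α x + (1 - α) m = Q x`. At `x = m` the quotient is `0 / 0 = 0`: this
  -- quality always gets the generic signal, which is what makes `α < 1` possible there.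
  set α : ℝ → ℝ := E.piecewise (fun x => (Q x - m) / (x - m)) (fun _ => 1) with hαd
  have hα : Measurable α :=
    ((hQm.sub_const m).div (measurable_id.sub_const m)).piecewise hEm measurable_const
  have hαE : ∀ x ∈ E, α x = (Q x - m) / (x - m) := fun x hx => piecewise_eq_of_mem _ _ _ hx
  have hαE' : ∀ x ∉ E, α x = 1 := fun x hx => piecewise_eq_of_notMem _ _ _ hx
  have h01 : ∀ x, 0 ≤ α x ∧ α x ≤ 1 := by
    intro x
    by_cases hx : x ∈ E
    · rw [hαE x hx]
      have hxu := hx.1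
      rcases lt_trichotomy x m with h | h | h
      · have hxu' : Q x ∈ Icc x m := by simpa [uIcc_of_le h.le] using hxu
        exact ⟨div_nonneg_of_nonpos (by linarith [hxu'.2]) (by linarith),
          (div_le_one_of_neg (by linarith)).2 (by linarith [hxu'.1])⟩
      · simp [h]
      · have hxu' : Q x ∈ Icc m x := by simpa [uIcc_of_ge h.le] using hxu
        exact ⟨div_nonneg (by linarith [hxu'.1]) (by linarith),
          (div_le_one (by linarith)).2 (by linarith [hxu'.2])⟩
    · rw [hαE' x hx]; simp
  -- Outside `E` quality is revealed. The price `qbar b` at `q b` concerns only the null type `b`,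
  -- so conditional expectation does not restrict it; other qualities outside `E` are priced `0` to
  -- deter deviations. The maximum with `0` matters only for negative arguments.
  set p₁ : ℝ → ℝ := E.piecewise (fun x => max x 0) (({q b} : Set ℝ).indicator fun _ => qbar b)
    with hp1
  have hp1m : Measurable p₁ := (measurable_id.max measurable_const).piecewise hEm
    (measurable_const.indicator (measurableSet_singleton _))
  have hbI : b ∈ Icc a b := right_mem_Icc.2 hab.le
  have hqb0 : 0 ≤ qbar b := signaled_nonneg hC hq hp hbI
  set p : ℝ ⊕ Unit → ℝ := Sum.elim p₁ (fun _ => m) with hpd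
  have hpm : Measurable p := measurable_fun_sum hp1m measurable_const
  have hp0 : ∀ s, 0 ≤ p s := by
    rintro (x | _)
    · simp only [hpd, Sum.elim_inl, hp1]
      by_cases hx : x ∈ E
      · rw [piecewise_eq_of_mem _ _ _ hx]; exact le_max_right _ _
      · rw [piecewise_eq_of_notMem _ _ _ hx]; exact indicator_nonneg (fun _ _ => hqb0) _
    · exact hm0
  have hpE : ∀ x ∈ E, 0 ≤ x → p (Sum.inl x) = x := by
    intro x hx hx0
    simp only [hpd, Sum.elim_inl, hp1]
    rw [piecewise_eq_of_mem _ _ _ hx, max_eq_left hx0]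
  have hpay : ∀ x, ∫ s, p s ∂(mixKernel α hα x) = α x * p (Sum.inl x) + (1 - α x) * m :=
    fun x => integral_mixKernel hα h01 hpm x
  have hmix : ∀ x ∈ E, α x * x + (1 - α x) * m = Q x := by
    intro x hx
    rw [hαE x hx]
    rcases eq_or_ne x m with h | h
    · have : Q m = m := by have := hx.1; simpa [h] using this
      simp [h, this]
    · have : x - m ≠ 0 := sub_ne_zero.2 h
      field_simp
      ring
  have hpayE : ∀ x ∈ E, 0 ≤ x → ∫ s, p s ∂(mixKernel α hα x) = Q x := by
    intro x hx hx0
    rw [hpay, hpE x hx hx0, hmix x hx]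
  have hpayE' : ∀ x ∉ E, ∫ s, p s ∂(mixKernel α hα x) =
      ({q b} : Set ℝ).indicator (fun _ => qbar b) x := by
    intro x hx
    rw [hpay, hαE' x hx]
    simp only [hpd, Sum.elim_inl, hp1]
    rw [piecewise_eq_of_notMem _ _ _ hx]; ring
  have hIco : ∀ t ∈ Ico a b, q t ∈ E := by
    intro t ht
    refine ⟨?_, fun h => ⟨t, ht, h⟩⟩
    rw [mem_ofPred_eq, hQ, signaledExtension_eq hC hq hic (Ico_subset_Icc_self ht)]
    exact hm t ht
  have hQq : ∀ t ∈ Icc a b, Q (q t) = qbar t := fun t ht => signaledExtension_eq hC hq hic ht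
  have hsig : ∀ t ∈ Icc a b, qbar t = ∫ s, p s ∂(mixKernel α hα (q t)) := by
    intro t ht
    by_cases hx : q t ∈ E
    · rw [hpayE _ hx (hq.1 t ht), hQq t ht]
    · have htb : t = b := by
        by_contra hne
        exact hx (hIco t ⟨ht.1, lt_of_le_of_ne ht.2 hne⟩)
      rw [hpayE' _ hx, htb]; simp
  have hqm : AEMeasurable q F := (integrable_of_monotoneOn hF hq.2).aemeasurable
  have hqbm : MonotoneOn qbar (Icc a b) := hic.signaled_mono hC hq
  refine ⟨mixKernel α hα, isMarkovKernel_mixKernel hα h01, p,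
    ⟨hq, hpm, hp0, fun x _ => integrable_mixKernel hα hpm x, ?_, hsig, ?_, hp⟩, ?_⟩
  · intro B hB
    have hMk := isMarkovKernel_mixKernel hα h01
    have hreal : Integrable (fun t => q t * (mixKernel α hα (q t)).real B) F := by
      refine (integrable_of_monotoneOn hF hq.2).mul_bdd (c := 1) ?_ ?_
      · exact (((Kernel.measurable_coe _ hB).ennreal_toReal).comp_aemeasurable
          hqm).aestronglyMeasurable
      · refine ae_of_all _ fun t => ?_
        rw [Real.norm_of_nonneg measureReal_nonneg]
        exact measureReal_le_one
    have hdi : Integrable (fun t => (qbar t - q t) *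
        B.indicator (1 : ℝ ⊕ Unit → ℝ) (Sum.inr ())) F :=
      ((integrable_of_monotoneOn hF hqbm).sub (integrable_of_monotoneOn hF hq.2)).mul_const _
    -- Type `t` is mispriced only at the generic signal, by `(1 - α) (m - q t) = qbar t - q t` on
    -- average. This has mean zero, so equality of means is all the price condition requires of `m`.
    have key : ∀ᵐ t ∂F, ∫ s in B, p s ∂(mixKernel α hα (q t)) =
        q t * (mixKernel α hα (q t)).real B +
          (qbar t - q t) * B.indicator (1 : ℝ ⊕ Unit → ℝ) (Sum.inr ()) := by
      filter_upwards [ae_mem_Ico hF] with t ht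
      have htI := Ico_subset_Icc_self ht
      have e1 := hmix _ (hIco t ht)
      rw [hQq t htI] at e1
      have e2 := hpE _ (hIco t ht) (hq.1 t htI)
      have e3 : p (Sum.inr ()) = m := rfl
      have hind : ∀ s, B.indicator p s = p s * B.indicator (1 : ℝ ⊕ Unit → ℝ) s := by
        intro s; by_cases hs : s ∈ B <;> simp [hs]
      rw [setIntegral_mixKernel hα h01 hpm hB, mixKernel_real hα h01 hB, hind, hind, e2, e3, ← e1]
      ring
    rw [integral_congr_ae key, integral_add hreal hdi, integral_mul_const,
      integral_sub (integrable_of_monotoneOn hF hqbm) (integrable_of_monotoneOn hF hq.2), hint]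
    simp
  · intro t ht x hx
    by_cases hxE : x ∈ E
    · rw [hpayE x hxE hx]
      exact signaledExtension_sub_le hC hq hic hp hx ht
    · rw [hpayE' x hxE]
      by_cases hxb : x = q b
      · rw [hxb]
        simpa using hic t ht b hbI
      · rw [indicator_of_notMem (by simpa using hxb)]
        have := hC.nonneg hx ht
        have := hp t ht
        linarith
  · intro hfix
    refine ⟨α, hα, h01, fun x => mixKernel_apply hα x, fun t ht => ⟨?_, ?_⟩⟩
    · have htI := Ico_subset_Icc_self ht
      refine lt_of_le_of_ne (h01 _).2 fun h1 => ?_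
      have e := hmix _ (hIco t ht)
      rw [h1, hQq t htI] at e
      have h2 := hfix t ht (by linarith)
      rw [hαE _ (hIco t ht), h2] at h1
      simp at h1
    · exact hpE _ (hIco t ht) (hq.1 t (Ico_subset_Icc_self ht))

omit hab hq in
/-- If qualities increase faster than signaled qualities, which have the same mean, then some
price separates the signaled qualities above and below the qualities. -/
lemma exists_generic_price {F : Measure ℝ} [IsProbabilityMeasure F] [NullSingletonClass F]
    (hab : a < b) (hq : IsQualityAllocation a b q) (hF : F.support = Icc a b)
    (hD : MonotoneOn (fun t => q t - qbar t) (Ico a b))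
    (hint : ∫ t, qbar t ∂F = ∫ t, q t ∂F) :
    ∃ m, 0 ≤ m ∧ (∀ t ∈ Ico a b, qbar t ∈ uIcc (q t) m) ∧
      ((∀ t ∈ Ico a b, ∀ t' ∈ Ico a b, q t = qbar t → q t' = qbar t' → qbar t = qbar t') →
        ∀ t ∈ Ico a b, qbar t = q t → q t = m) := by
  have hqbm : MonotoneOn qbar (Icc a b) := hic.signaled_mono hC hq
  have haI : a ∈ Ico a b := left_mem_Ico.2 hab
  have hda : q a ≤ qbar a := by
    by_contra! hlt
    have hqi := integrable_of_monotoneOn (F := F) hF hq.2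
    have hqbi := integrable_of_monotoneOn (F := F) hF hqbm
    have hle : ∫ t, (q a - qbar a) ∂F ≤ ∫ t, (q t - qbar t) ∂F := by
      refine integral_mono_ae (integrable_const _) (hqi.sub hqbi) ?_
      filter_upwards [ae_mem_Ico hF] with t ht using hD haI ht ht.1
    rw [integral_sub hqi hqbi, hint] at hle
    simp at hle
    linarith
  -- By monotonicity of the gap this is an initial segment of `[a, b)`, and it contains `a` because
  -- the gap has mean zero. The supremum of `qbar` over it separates the two regimes.
  set A : Set ℝ := {t ∈ Ico a b | q t ≤ qbar t} with hA
  have hbdd : BddAbove (qbar '' A) := by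
    refine ⟨qbar b, ?_⟩
    rintro _ ⟨s, hs, rfl⟩
    exact hqbm (Ico_subset_Icc_self hs.1) (right_mem_Icc.2 hab.le) hs.1.2.le
  have hle : ∀ t ∈ A, qbar t ≤ sSup (qbar '' A) := fun t ht => le_csSup hbdd ⟨t, ht, rfl⟩
  have hne : (qbar '' A).Nonempty := ⟨_, a, ⟨haI, hda⟩, rfl⟩
  refine ⟨sSup (qbar '' A), ?_, ?_, ?_⟩
  · exact (signaled_nonneg hC hq hp (Ico_subset_Icc_self haI)).trans (hle a ⟨haI, hda⟩)
  · intro t ht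
    rw [mem_uIcc]
    by_cases h : q t ≤ qbar t
    · exact Or.inl ⟨h, hle t ⟨ht, h⟩⟩
    · push Not at h
      refine Or.inr ⟨csSup_le hne ?_, h.le⟩
      rintro _ ⟨s, ⟨hs, hsq⟩, rfl⟩
      refine hqbm (Ico_subset_Icc_self hs) (Ico_subset_Icc_self ht) ?_
      by_contra! hlt
      have := hD ht hs hlt.le
      dsimp only at this
      linarith
  · intro hfix t ht hqt
    refine le_antisymm (hqt ▸ hle t ⟨ht, hqt.ge⟩) (csSup_le hne ?_)
    rintro _ ⟨s, ⟨hs, hsq⟩, rfl⟩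
    rcases le_total s t with h | h
    · rw [← hqt]; exact hqbm (Ico_subset_Icc_self hs) (Ico_subset_Icc_self ht) h
    · have h1 := hD ht hs h
      dsimp only at h1
      have : q s = qbar s := by linarith
      rw [← hqt]
      exact (hfix s hs t ht this hqt.symm).le

end Implementation

/-! ### Quantitative strict submodularity and convexity. -/

section StrictCost

variable {a b : ℝ} {C : ℝ → ℝ → ℝ} (hC : IsCost a b C) (hab : a < b)
include hC hab

lemma IsCost.exists_costQT_le_neg (hS : IsStrictlySubmodular a b C) {c X : ℝ} (hc : 0 < c)
    (hcX : c ≤ X) : ∃ κ > 0, ∀ x ∈ Icc c X, ∀ t ∈ Icc a b, costQT a b C x t ≤ -κ := by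
  obtain ⟨z, hz, hmax⟩ := (isCompact_Icc.prod isCompact_Icc :
    IsCompact (Icc c X ×ˢ Icc a b)).exists_isMaxOn
    ⟨(c, a), left_mem_Icc.2 hcX, left_mem_Icc.2 hab.le⟩
    ((hC.continuousOn_costQT hab).mono (prod_mono (fun x hx => hc.le.trans hx.1) subset_rfl))
  refine ⟨-costQT a b C z.1 z.2, neg_pos.2 (hS _ (hc.trans_le hz.1.1) _ hz.2), fun x hx t ht => ?_⟩
  rw [neg_neg]
  exact hmax (mk_mem_prod hx ht)

/-- A quality slightly above `c` still has marginal cost below one. -/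
lemma IsCost.exists_costQ_add_lt_one {c t : ℝ} (hc : 0 ≤ c) (ht : t ∈ Icc a b)
    (h : costQ C c t < 1) : ∃ ε > 0, costQ C (c + ε) t < 1 := by
  have hcont : ContinuousWithinAt (fun x => costQ C x t) (Ioi c) c :=
    (hC.hasDeriv_qq hab hc ht).continuousWithinAt.mono fun y hy => hc.trans (mem_Ioi.1 hy).le
  obtain ⟨x, hx, hxc⟩ := ((hcont.eventually_lt_const h).and self_mem_nhdsWithin).exists
  exact ⟨x - c, sub_pos.2 hxc, by simpa using hx⟩

/-- If the average marginal cost between `c` and `z` is at least one, then so is that between `c`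
and any larger quality. -/
lemma IsCost.sub_le_sub_of_le {c z y t : ℝ} (hc : 0 ≤ c) (hcz : c < z) (hzy : z ≤ y)
    (ht : t ∈ Icc a b) (h : z - c ≤ C z t - C c t) : y - c ≤ C y t - C c t := by
  have h1 := hC.sub_le_costQ_mul hab hc hcz.le ht
  have h2 := hC.costQ_mul_le_sub hab (hc.trans hcz.le) hzy ht
  have h3 : 1 ≤ costQ C z t := by
    by_contra! hlt
    nlinarith
  nlinarith

end StrictCost

/-! ### Two profitable perturbations: lowering an interior rise, raising the top. -/

section Perturbation

variable {a b : ℝ} {C : ℝ → ℝ → ℝ} {F : Measure ℝ} [IsProbabilityMeasure F]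
  [NullSingletonClass F] {w q : ℝ → ℝ}
variable (hC : IsCost a b C) (hab : a < b) (hF : F.support = Icc a b)
  (hw : AntitoneOn w (Icc a b)) (hw1 : ∫ t, w t ∂F = 1)

omit [IsProbabilityMeasure F] in
lemma exists_measureReal_Ioo_lt [IsFiniteMeasure F] {s₀ s₁ r : ℝ} (h : s₀ < s₁) (hr : 0 < r) :
    ∃ s ∈ Ioc s₀ s₁, F.real (Ioo s₀ s) < r := by
  have ht := tendsto_measure_Icc F s₀
  have hev := ht.eventually_lt_const (ENNReal.ofReal_pos.2 hr)
  obtain ⟨δ, hδ, hball⟩ := Metric.eventually_nhds_iff.1 hev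
  refine ⟨min s₁ (s₀ + δ / 2), ⟨lt_min h (by linarith), min_le_left _ _⟩, ?_⟩
  have h1 : F (Icc (s₀ - δ / 2) (s₀ + δ / 2)) < ENNReal.ofReal r :=
    hball (by rw [Real.dist_eq, sub_zero, abs_of_pos (by linarith)]; linarith)
  have hsub : Ioo s₀ (min s₁ (s₀ + δ / 2)) ⊆ Icc (s₀ - δ / 2) (s₀ + δ / 2) := fun x hx =>
    ⟨by linarith [hx.1], hx.2.le.trans (min_le_right _ _)⟩
  have h2 : F (Ioo s₀ (min s₁ (s₀ + δ / 2))) < ENNReal.ofReal r :=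
    (measure_mono hsub).trans_lt h1
  exact (ENNReal.lt_ofReal_iff_toReal_lt (measure_ne_top _ _)).1 h2

include hC hab hF hw hw1

/-- At a solution of the relaxed problem, qualities do not start to rise above a level `c > 0` at an
interior type whose average marginal cost above `c` is at least one: lowering qualities
slightly would save first-order rents at a second-order cost in surplus. -/
lemma SolvesRelaxed.false_of_le_cost_sub (h : SolvesRelaxed a b C F w q)
    (hS : IsStrictlySubmodular a b C) (hne : ¬ ∀ᵐ t ∂F, w t = 1) {c s₀ s₁ : ℝ} (hc : 0 < c)
    (h0 : a < s₀) (h01 : s₀ < s₁) (h1 : s₁ < b) (hlow : ∀ s ∈ Icc a b, s < s₀ → q s ≤ c)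
    (hhigh : ∀ s ∈ Ioo s₀ s₁, c < q s ∧ q s - c ≤ C (q s) s₀ - C c s₀) : False := by
  have hq : IsQualityAllocation a b q := h.choose_spec.1.allocation
  have hbI : b ∈ Icc a b := right_mem_Icc.2 hab.le
  have hs₀I : s₀ ∈ Icc a b := ⟨h0.le, (h01.trans h1).le⟩
  have hcb : c ≤ q b := by
    have hm : (s₀ + s₁) / 2 ∈ Ioo s₀ s₁ := ⟨by linarith, by linarith⟩
    exact (hhigh _ hm).1.le.trans (hq.2 ⟨by linarith [hm.1], by linarith [hm.2]⟩ hbI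
      (by linarith [hm.2]))
  obtain ⟨κ, hκ, hκle⟩ := hC.exists_costQT_le_neg hab hS hc hcb
  obtain ⟨M, hM0, hM⟩ := hC.exists_costQT_bound hab (q b)
  have hum := monotoneOn_one_sub_weight hw
  have hu0 := integral_one_sub_weight hF hw hw1
  have hui : Integrable (fun t => 1 - w t) F := (integrable_const 1).sub (integrable_weight hF hw)
  have hune : ¬ ∀ᵐ t ∂F, 1 - w t = 0 := fun hh => hne (hh.mono fun t ht => by linarith)
  have hone : ¬ ∀ᵐ t ∂F, (1 : ℝ) = 0 := fun hh => by
    obtain ⟨t, ht⟩ := hh.exists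
    exact one_ne_zero ht
  have h1nn : (0 : ℝ) ≤ ∫ _, (1 : ℝ) ∂F := by simp
  -- By quasi-concavity `γ` bounds both tails from below on all of `[s₀, s₁]`.
  set γ := min (min (tail b F (fun t => 1 - w t) s₀) (tail b F (fun t => 1 - w t) s₁))
    (min (tail b F (fun _ => 1) s₀) (tail b F (fun _ => 1) s₁)) with hγ
  have hI0 : s₀ ∈ Ioo a b := ⟨h0, h01.trans h1⟩
  have hI1 : s₁ ∈ Ioo a b := ⟨h0.trans h01, h1⟩
  have hγ0 : 0 < γ := lt_min
    (lt_min (tail_pos hF hum hu0.ge hune hI0) (tail_pos hF hum hu0.ge hune hI1))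
    (lt_min (tail_pos hF monotoneOn_const h1nn hone hI0)
      (tail_pos hF monotoneOn_const h1nn hone hI1))
  -- The loss of surplus will be at most `M (s₂ - s₀) ε F(s₀, s₂)` and the saving of rents at least
  -- `κ ε γ (s₂ - s₀) / 2`. The length cancels, so small mass near `s₀`, available without atoms,
  -- decides.
  obtain ⟨s₂, hs₂, hFs⟩ := exists_measureReal_Ioo_lt (F := F) h01
    (r := κ * γ / (2 * M)) (by positivity)
  set mid := (s₀ + s₂) / 2 with hmid
  have hm0 : s₀ < mid := by linarith [hs₂.1]
  have hm2 : mid < s₂ := by linarith [hs₂.1]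
  have hmI : mid ∈ Icc a b := ⟨by linarith, by linarith [hs₂.2]⟩
  set ε := q mid - c with hε
  have hε0 : 0 < ε := sub_pos.2 (hhigh mid ⟨hm0, by linarith [hs₂.2]⟩).1
  -- Lower quality by `ε`, but not past `c`, and only below `s₂`. As `ε = q mid - c`, the reduction
  -- is full on `(mid, s₂)`.
  set q' : ℝ → ℝ := fun s => if s < s₂ then min (q s) (max c (q s - ε)) else q s with hq'd
  have hq'le : ∀ s, q' s ≤ q s := by
    intro s
    simp only [hq'd]
    split_ifs
    · exact min_le_left _ _
    · exact le_rfl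
  have hq' : IsQualityAllocation a b q' := by
    refine ⟨fun t ht => ?_, fun t ht t' ht' htt => ?_⟩
    · simp only [hq'd]
      split_ifs
      · exact le_min (hq.1 t ht) (hc.le.trans (le_max_left _ _))
      · exact hq.1 t ht
    · have hqq := hq.2 ht ht' htt
      by_cases h' : t' < s₂
      · simp only [hq'd, if_pos h', if_pos (htt.trans_lt h')]
        exact min_le_min hqq (max_le_max le_rfl (by linarith))
      · refine (hq'le t).trans (hqq.trans ?_)
        simp [hq'd, if_neg h']
  have hq'low : ∀ s ∈ Icc a b, s < s₀ → q' s = q s := by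
    intro s hs hlt
    simp only [hq'd]
    rw [if_pos (hlt.trans hs₂.1), min_eq_left ((hlow s hs hlt).trans (le_max_left _ _))]
  have hq'high : ∀ s, s₂ ≤ s → q' s = q s := by
    intro s hs
    simp only [hq'd]
    rw [if_neg (not_lt.2 hs)]
  have hq'mid : ∀ s ∈ Ioo s₀ s₂, c ≤ q' s ∧ q s - ε ≤ q' s := by
    intro s hs
    have := (hhigh s ⟨hs.1, hs.2.trans_le hs₂.2⟩).1
    simp only [hq'd]
    rw [if_pos hs.2]
    exact ⟨le_min this.le (le_max_left _ _), le_min (by linarith) (le_max_right _ _)⟩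
  have hq'top : ∀ s ∈ Ioo mid s₂, q' s = q s - ε := by
    intro s hs
    have h3 : q mid ≤ q s := hq.2 hmI ⟨hmI.1.trans hs.1.le, by linarith [hs.2, hs₂.2]⟩ hs.1.le
    simp only [hq'd]
    rw [if_pos hs.2, max_eq_right (by linarith), min_eq_right (by linarith)]
  have hsI : ∀ s ∈ Ioo s₀ s₂, s ∈ Icc a b := fun s hs =>
    ⟨(h0.trans hs.1).le, by linarith [hs.2, hs₂.2]⟩
  have hη : 0 < s₂ - s₀ := sub_pos.2 hs₂.1
  have hsurplus : ∀ s ∈ Ioo s₀ s₂, -(M * (s₂ - s₀) * ε) ≤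
      (q' s - C (q' s) s) - (q s - C (q s) s) := by
    intro s hs
    have hsI' := hsI s hs
    obtain ⟨hcq, hslope⟩ := hhigh s ⟨hs.1, hs.2.trans_le hs₂.2⟩
    obtain ⟨hcq', hqε⟩ := hq'mid s hs
    have hle := hq'le s
    have hdiff := (sub_mem_of_hasDerivWithinAt (f := fun z => C z s₀ - C z s)
      (f' := fun z => costQ C z s₀ - costQ C z s) (m := 0) (M := M * (s - s₀)) hcq.le
      (fun z hz => (((hC.hasDeriv_q (hc.le.trans hz.1) hs₀I).sub
        (hC.hasDeriv_q (hc.le.trans hz.1) hsI')).mono fun _ hw => hc.le.trans hw.1))).2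
      (fun z hz => by
        have := hC.costQ_le_add hab hM (x := z)
          ⟨hc.le.trans hz.1, hz.2.trans (hq.2 hsI' hbI hsI'.2)⟩ h0.le hs.1.le hsI'.2
        linarith)
    have hM2 : M * (s - s₀) ≤ M * (s₂ - s₀) :=
      mul_le_mul_of_nonneg_left (by linarith [hs.2]) hM0.le
    set L := M * (s₂ - s₀) with hL
    have hL0 : 0 < L := mul_pos hM0 hη
    -- The chord slope is at least one for type `s₀`, hence at least `1 - L` for the nearby type
    -- `s`. By convexity the chord over the upper piece `[q' s, q s]` is at least as steep, so the
    -- lost surplus is at most `L ε`.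
    have hchord : (1 - L) * (q s - c) ≤ C (q s) s - C c s := by nlinarith
    have e1 := hC.costQ_mul_le_sub hab (hc.le.trans hcq') hle hsI'
    have e2 := hC.sub_le_costQ_mul hab hc.le hcq' hsI'
    have e3 : (1 - L) * (q s - q' s) ≤ C (q s) s - C (q' s) s := by
      rcases le_total (1 - L) (costQ C (q' s) s) with hk | hk
      · exact (mul_le_mul_of_nonneg_right hk (by linarith)).trans e1
      · have := mul_le_mul_of_nonneg_right hk (sub_nonneg.2 hcq')
        nlinarith
    have e4 : L * (q s - q' s) ≤ L * ε := mul_le_mul_of_nonneg_left (by linarith) hL0.le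
    linarith
  have hgain : ∀ u : ℝ → ℝ, MonotoneOn u (Icc a b) → Integrable u F →
      (∀ s ∈ Icc a b, 0 ≤ tail b F u s) → γ ≤ min (tail b F u s₀) (tail b F u s₁) →
      objective a b C F (tail b F u) q < objective a b C F (tail b F u) q' := by
    intro u hu hui hunn huγ
    have key := add_le_objective_sub hC hab hF hq hq' hui
      (A := (Ioo s₀ s₂).indicator fun _ => -(M * (s₂ - s₀) * ε))
      (B := (Ioo mid s₂).indicator fun _ => κ * ε * γ)
      ((integrable_const _).indicator measurableSet_Ioo)
      (IntegrableOn.indicator (integrableOn_const measure_Ioc_lt_top.ne) measurableSet_Ioo) ?_ ?_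
    · rw [integral_indicator measurableSet_Ioo, setIntegral_const,
        integral_indicator measurableSet_Ioo, Measure.restrict_restrict measurableSet_Ioo,
        inter_eq_left.2 (show Ioo mid s₂ ⊆ Ioc a b from fun s hs =>
          ⟨by linarith [hs.1], by linarith [hs.2, hs₂.2]⟩), setIntegral_const,
        Real.volume_real_Ioo_of_le hm2.le] at key
      simp only [smul_eq_mul] at key
      rw [lt_div_iff₀ (by positivity)] at hFs
      have e1 : s₂ - mid = (s₂ - s₀) / 2 := by rw [hmid]; ring
      rw [e1] at key
      have e2 : 0 < ((s₂ - s₀) * ε) * (κ * γ - F.real (Ioo s₀ s₂) * (2 * M)) :=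
        mul_pos (mul_pos hη hε0) (sub_pos.2 hFs)
      nlinarith
    · filter_upwards [compl_mem_ae_iff.2 (measure_singleton s₀ : F {s₀} = 0)] with t hts ht
      rcases lt_or_ge t s₀ with hlt | hge
      · rw [indicator_of_notMem (fun hh => absurd hh.1 (not_lt.2 hlt.le)), hq'low t ht hlt,
          sub_self]
      · have hgt : s₀ < t := lt_of_le_of_ne hge (fun hh => hts hh.symm)
        rcases lt_or_ge t s₂ with hlt | hge2
        · rw [indicator_of_mem (show t ∈ Ioo s₀ s₂ from ⟨hgt, hlt⟩)]
          exact hsurplus t ⟨hgt, hlt⟩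
        · rw [indicator_of_notMem (fun hh => absurd hh.2 (not_lt.2 hge2)), hq'high t hge2, sub_self]
    · refine ae_of_all _ fun s hs => ?_
      have hbase : 0 ≤ (costT a b C (q' s) s - costT a b C (q s) s) * tail b F u s :=
        mul_nonneg (sub_nonneg.2 (hC.costT_anti hab (hq'.1 s hs) (hq'le s) hs)) (hunn s hs)
      by_cases hsm : s ∈ Ioo mid s₂
      · rw [indicator_of_mem hsm]
        have hs' : s ∈ Ioo s₀ s₂ := ⟨hm0.trans hsm.1, hsm.2⟩
        have hcq' := (hq'mid s hs').1
        have e1 := hC.costT_sub_le hab (hc.le.trans hcq') (hq'le s) le_rfl hab le_rfl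
          (M := -κ) (fun z hz r hr => hκle z ⟨hcq'.trans hz.1,
            hz.2.trans (hq.2 hs hbI hs.2)⟩ r hr) hs
        rw [hq'top s hsm] at e1 ⊢
        have e2 : γ ≤ tail b F u s :=
          huγ.trans (min_tail_le hu hui h0.le hs'.1.le (hs'.2.le.trans hs₂.2) h1.le)
        exact mul_le_mul (by linarith) e2 hγ0.le (by nlinarith)
      · rwa [indicator_of_notMem hsm]
  have g1 := hgain _ monotoneOn_const (integrable_const 1)
    (fun s hs => tail_nonneg hF monotoneOn_const h1nn hs) (min_le_right _ _)
  have g2 := hgain _ hum hui (fun s hs => tail_one_sub_weight_nonneg hF hw hw1 hs) (min_le_left _ _)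
  exact absurd (h.objective_le hC hab hF hw hw1 hq' g1.le) (not_le.2 g2)

/-- A solution of the relaxed problem is not constant: raising the top qualities pays. -/
lemma SolvesRelaxed.not_forall_eq_const (h : SolvesRelaxed a b C F w q)
    (hS : IsStrictlySubmodular a b C) (c : ℝ) : ¬ ∀ t ∈ Ioo a b, q t = c := by
  intro hqc
  have hq : IsQualityAllocation a b q := h.choose_spec.1.allocation
  have hbI : b ∈ Icc a b := right_mem_Icc.2 hab.le
  set r := (a + 2 * b) / 3 with hr
  set r' := (2 * a + b) / 3 with hr'
  have hrI : r ∈ Ioo a b := ⟨by linarith, by linarith⟩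
  have hrI' : r' ∈ Ioo a b := ⟨by linarith, by linarith⟩
  have hc0 : 0 ≤ c := hqc r hrI ▸ hq.1 r (Ioo_subset_Icc_self hrI)
  -- For `c > 0`, the bound one at the lower type `r'` and strict submodularity give strictness at
  -- `r`.
  have hlt1 : costQ C c r < 1 := by
    rcases hc0.eq_or_lt with h0 | hc
    · rw [← h0, hC.costQ_zero r (Ioo_subset_Icc_self hrI)]; exact one_pos
    · obtain ⟨κ, hκ, hκle⟩ := hC.exists_costQT_le_neg hab hS hc le_rfl
      have e1 := (hC.costQ_sub_bounds (m := 0) (M := -κ) (t := r) hab hc0 hrI'.1.le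
        (by linarith) hrI.2.le).2 fun s hs => hκle c ⟨le_rfl, le_rfl⟩ s
          ⟨hrI'.1.le.trans hs.1, hs.2.trans hrI.2.le⟩
      have e2 := h.costQ_le_one hC hab hF hw hw1 (Ioo_subset_Ico_self hrI')
      rw [hqc r' hrI'] at e2
      nlinarith
  obtain ⟨ε, hε, hε1⟩ := hC.exists_costQ_add_lt_one hab hc0 (Ioo_subset_Icc_self hrI) hlt1
  set δ := 1 - costQ C (c + ε) r with hδ
  have hδ0 : 0 < δ := sub_pos.2 hε1
  obtain ⟨M, hM0, hM⟩ := hC.exists_costQT_bound hab (c + ε)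
  set K := max 1 (1 - w b) with hK
  have hK0 : 0 < K := one_pos.trans_le (le_max_left _ _)
  -- Raising quality by `ε` on `[s₁, b]` gains at least `ε δ F[s₁, b]` in surplus and costs at most
  -- `M ε K F[s₁, b] (b - s₁)` in rents. The mass cancels, so `M K (b - s₁) < δ` suffices; `K`
  -- bounds both `1` and `1 - w`.
  set s₁ := max r (b - δ / (2 * (M * K))) with hs₁
  have hs₁b : s₁ < b := max_lt hrI.2 (by have : 0 < δ / (2 * (M * K)) := by positivity
                                         linarith)
  have hs₁r : r ≤ s₁ := le_max_left _ _
  have hs₁δ : M * K * (b - s₁) < δ := by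
    have e1 : b - s₁ ≤ δ / (2 * (M * K)) := by
      have := le_max_right r (b - δ / (2 * (M * K)))
      linarith
    have e2 := mul_le_mul_of_nonneg_left e1 (mul_pos hM0 hK0).le
    have e3 : M * K * (δ / (2 * (M * K))) = δ / 2 := by field_simp
    linarith
  set q' : ℝ → ℝ := fun s => if s < s₁ then q s else max (q s) (c + ε) with hq'd
  have hle : ∀ s, q s ≤ q' s := by
    intro s
    simp only [hq'd]
    split_ifs
    · exact le_rfl
    · exact le_max_left _ _
  have hq' : IsQualityAllocation a b q' := by
    refine ⟨fun t ht => (hq.1 t ht).trans (hle t), fun t ht t' ht' htt => ?_⟩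
    by_cases ht1 : t < s₁
    · refine le_trans ?_ ((hq.2 ht ht' htt).trans (hle t'))
      simp [hq'd, ht1]
    · simp only [hq'd, if_neg ht1, if_neg (fun hh => ht1 (htt.trans_lt hh))]
      exact max_le_max (hq.2 ht ht' htt) le_rfl
  have hlow : ∀ s, s < s₁ → q' s = q s := fun s hs => by simp [hq'd, hs]
  have hhigh : ∀ s ∈ Icc a b, s₁ ≤ s → s ≠ b → q s = c ∧ q' s = c + ε := by
    intro s hs hs1 hsb
    have e := hqc s ⟨by linarith [hrI.1], lt_of_le_of_ne hs.2 hsb⟩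
    refine ⟨e, ?_⟩
    simp only [hq'd]
    rw [if_neg (not_lt.2 hs1), e, max_eq_right (by linarith)]
  have hFp : 0 < F.real (Icc s₁ b) := measureReal_pos_of_Ioo_subset hF (by linarith [hrI.1])
    hs₁b le_rfl Ioo_subset_Icc_self
  have hgain : ∀ u : ℝ → ℝ, Integrable u F → (∀ s ∈ Icc a b, 0 ≤ tail b F u s) →
      (∀ t ∈ Icc a b, u t ≤ K) →
      objective a b C F (tail b F u) q < objective a b C F (tail b F u) q' := by
    intro u hui hunn huK
    have key := add_le_objective_sub hC hab hF hq hq' hui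
      (A := (Icc s₁ b).indicator fun _ => ε * δ)
      (B := (Icc s₁ b).indicator fun _ => -(M * ε * (K * F.real (Icc s₁ b))))
      ((integrable_const _).indicator measurableSet_Icc)
      (IntegrableOn.indicator (integrableOn_const measure_Ioc_lt_top.ne) measurableSet_Icc) ?_ ?_
    · rw [integral_indicator measurableSet_Icc, setIntegral_const,
        integral_indicator measurableSet_Icc, Measure.restrict_restrict measurableSet_Icc,
        inter_eq_left.2 (show Icc s₁ b ⊆ Ioc a b from fun s hs =>
          ⟨by linarith [hrI.1, hs.1], hs.2⟩),
        setIntegral_const, Real.volume_real_Icc_of_le hs₁b.le] at key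
      simp only [smul_eq_mul] at key
      have e2 : 0 < (ε * F.real (Icc s₁ b)) * (δ - M * K * (b - s₁)) :=
        mul_pos (mul_pos hε hFp) (sub_pos.2 hs₁δ)
      nlinarith
    · filter_upwards [compl_mem_ae_iff.2 (measure_singleton b : F {b} = 0)] with t htb ht
      rcases lt_or_ge t s₁ with hlt | hge
      · rw [indicator_of_notMem (fun hh => absurd hh.1 (not_le.2 hlt)), hlow t hlt, sub_self]
      · obtain ⟨e1, e2⟩ := hhigh t ht hge htb
        rw [indicator_of_mem (show t ∈ Icc s₁ b from ⟨hge, ht.2⟩), e1, e2]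
        have e3 := hC.sub_le_costQ_mul hab hc0 (show c ≤ c + ε by linarith) ht
        have e4 := hC.costQ_anti hab (x := c + ε) (by linarith) hrI.1.le (hs₁r.trans hge) ht.2
        have e5 : costQ C (c + ε) t * (c + ε - c) ≤ (1 - δ) * ε := by
          rw [add_sub_cancel_left]
          exact mul_le_mul_of_nonneg_right (by linarith) hε.le
        linarith
    · filter_upwards [compl_mem_ae_iff.2 (measure_singleton b : volume {b} = 0)] with s hsb hs
      rcases lt_or_ge s s₁ with hlt | hgt
      · rw [indicator_of_notMem (fun hh => absurd hh.1 (not_le.2 hlt)), hlow s hlt, sub_self,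
          zero_mul]
      · obtain ⟨e1, e2⟩ := hhigh s hs hgt hsb
        rw [indicator_of_mem (show s ∈ Icc s₁ b from ⟨hgt, hs.2⟩), e1, e2]
        have e3 := hC.le_costT_sub hab hc0 (show c ≤ c + ε by linarith)
          (fun z hz => hM z ⟨hc0.trans hz.1, hz.2⟩) hs
        rw [add_sub_cancel_left] at e3
        have e4 : tail b F u s ≤ K * F.real (Icc s₁ b) :=
          (tail_le_mul hui fun t ht => huK t ⟨hs.1.trans ht.1, ht.2⟩).trans
            (mul_le_mul_of_nonneg_left (measureReal_mono (Icc_subset_Icc_left hgt)) hK0.le)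
        have e5 := mul_le_mul_of_nonneg_right e3 (hunn s hs)
        have e6 := mul_le_mul_of_nonneg_left e4 (mul_pos hM0 hε).le
        linarith
  have h1nn : (0 : ℝ) ≤ ∫ _, (1 : ℝ) ∂F := by simp
  have g1 := hgain _ (integrable_const 1) (fun s hs => tail_nonneg hF monotoneOn_const h1nn hs)
    fun _ _ => le_max_left _ _
  have g2 := hgain _ ((integrable_const 1).sub (integrable_weight hF hw))
    (fun s hs => tail_one_sub_weight_nonneg hF hw hw1 hs)
    fun t ht => (sub_le_sub_left (hw ht hbI ht.2) 1).trans (le_max_right _ _)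
  exact absurd (h.objective_le hC hab hF hw hw1 hq' g1.le) (not_le.2 g2)

end Perturbation

/-! ### Where majorization binds, and rigidity of the gap. -/

section Slackness

/-- If `f t ≥ 0`, then `f ≥ 0` above `t` while its integral there is nonpositive, so it vanishes
a.e. above; if `f t ≤ 0`, the same holds below with signs reversed. Either way `f t = 0`, so both
conclusions apply, and monotonicity with full support upgrades them to every interior point. -/
lemma eqOn_zero_of_setIntegral_nonneg {a b : ℝ} {F : Measure ℝ} [IsProbabilityMeasure F]
    [NullSingletonClass F] (hF : F.support = Icc a b) {f : ℝ → ℝ} (hf : MonotoneOn f (Ico a b))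
    (hfi : Integrable f F) (hf0 : ∫ s, f s ∂F = 0) {t : ℝ} (ht : t ∈ Ioo a b)
    (hpos : 0 ≤ ∫ s in Icc a t, f s ∂F) : ∀ s ∈ Ioo a b, f s = 0 := by
  have hsum := integral_add_compl (μ := F) (measurableSet_Icc (a := a) (b := t)) hfi
  rw [hf0] at hsum
  have htI := Ioo_subset_Ico_self ht
  have hcompl : ∀ᵐ s ∂F, s ∈ (Icc a t)ᶜ → s ∈ Ioo t b := by
    filter_upwards [ae_mem_Ico hF] with s hs hs'
    refine ⟨?_, hs.2⟩
    by_contra! hle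
    exact hs' ⟨hs.1, hle⟩
  have hlow : ∀ s ∈ Ioc a t, (∀ r ∈ Ico a t, f r ≤ 0) ∧ f t ≤ 0 → 0 ≤ f s := by
    intro s hs hnp
    have hle : ∀ r ∈ Icc a t, f r ≤ 0 := fun r hr =>
      hr.2.lt_or_eq.elim (fun h => hnp.1 r ⟨hr.1, h⟩) (fun h => h ▸ hnp.2)
    have h0 : ∫ r in Icc a t, -f r ∂F = 0 := by
      have := setIntegral_nonpos (μ := F) measurableSet_Icc hle
      rw [integral_neg]; linarith
    have hae := (ae_restrict_iff' measurableSet_Icc).1 ((setIntegral_eq_zero_iff_of_nonneg_ae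
      ((ae_restrict_mem measurableSet_Icc).mono fun r hr => neg_nonneg.2 (hle r hr))
      hfi.neg.integrableOn).1 h0)
    obtain ⟨r, hr, hr0⟩ := exists_mem_Ioo_of_ae hF le_rfl hs.1 (hs.2.trans ht.2.le) hae
    have h1 := hr0 ⟨hr.1.le, hr.2.le.trans hs.2⟩
    have h2 := hf ⟨hr.1.le, by linarith [hr.2, hs.2, ht.2]⟩ ⟨hs.1.le, hs.2.trans_lt ht.2⟩ hr.2.le
    simp only [Pi.zero_apply] at h1
    linarith
  have hhigh : ∀ s ∈ Ico t b, 0 ≤ f t → f s ≤ 0 := by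
    intro s hs hnn
    have hge : 0 ≤ᵐ[F.restrict (Icc a t)ᶜ] f := by
      filter_upwards [ae_restrict_mem measurableSet_Icc.compl, ae_restrict_of_ae hcompl]
        with r hr hr'
      exact hnn.trans (hf htI ⟨ht.1.le.trans (hr' hr).1.le, (hr' hr).2⟩ (hr' hr).1.le)
    have h0 : ∫ r in (Icc a t)ᶜ, f r ∂F = 0 := by
      have := integral_nonneg_of_ae hge
      linarith
    have hae := (ae_restrict_iff' measurableSet_Icc.compl).1
      ((setIntegral_eq_zero_iff_of_nonneg_ae hge hfi.integrableOn).1 h0)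
    obtain ⟨r, hr, hr0⟩ := exists_mem_Ioo_of_ae hF (ht.1.le.trans hs.1) hs.2 le_rfl hae
    have h1 := hr0 fun hh => absurd hh.2 (not_le.2 (hs.1.trans_lt hr.1))
    have h2 := hf ⟨ht.1.le.trans hs.1, hs.2⟩ ⟨by linarith [hs.1, hr.1, ht.1], hr.2⟩ hr.1.le
    simp only [Pi.zero_apply] at h1
    linarith
  have ht0 : f t = 0 := by
    rcases le_total 0 (f t) with h | h
    · exact le_antisymm (hhigh t ⟨le_rfl, ht.2⟩ h) h
    · exact le_antisymm h (hlow t ⟨ht.1, le_rfl⟩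
        ⟨fun r hr => (hf ⟨hr.1, hr.2.trans ht.2⟩ htI hr.2.le).trans h, h⟩)
  intro s hs
  rcases le_total s t with h | h
  · refine le_antisymm (ht0 ▸ hf (Ioo_subset_Ico_self hs) htI h) (hlow s ⟨hs.1, h⟩
      ⟨fun r hr => ht0 ▸ hf ⟨hr.1, hr.2.trans ht.2⟩ htI hr.2.le, ht0.le⟩)
  · exact le_antisymm (hhigh s ⟨h, hs.2⟩ ht0.ge) (ht0 ▸ hf htI (Ioo_subset_Ico_self hs) h)

variable {a b : ℝ} {C : ℝ → ℝ → ℝ} {F : Measure ℝ} [IsProbabilityMeasure F]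
  [NullSingletonClass F] {w q qbar : ℝ → ℝ}
variable (hC : IsCost a b C) (hab : a < b) (hF : F.support = Icc a b)
  (hw : AntitoneOn w (Icc a b)) (hw1 : ∫ t, w t ∂F = 1)
include hC hab hF hw hw1

/-- At a solution of the relaxed problem, interior types with different qualities have different
gaps between quality and signaled quality. -/
lemma SolvesRelaxed.quality_eq_of_sub_eq (h : SolvesRelaxed a b C F w q)
    (hS : IsStrictlySubmodular a b C) (hne : ¬ ∀ᵐ t ∂F, w t = 1) (hic : OnPathIC a b C q qbar)
    {t t' : ℝ} (ht : a < t) (htt : t < t') (ht' : t' < b)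
    (hD : q t - qbar t = q t' - qbar t') : q t = q t' := by
  by_contra hqne
  have hq : IsQualityAllocation a b q := h.choose_spec.1.allocation
  have hmono := hic.monotoneOn_sub hC hab hq fun s hs => h.costQ_le_one hC hab hF hw hw1 hs
  have hI : ∀ s ∈ Icc t t', s ∈ Icc a b := fun s hs => ⟨ht.le.trans hs.1, hs.2.trans ht'.le⟩
  have hI' : ∀ s ∈ Icc t t', s ∈ Ico a b := fun s hs => ⟨ht.le.trans hs.1, hs.2.trans_lt ht'⟩
  have htI := left_mem_Icc.2 htt.le
  have htI' := right_mem_Icc.2 htt.le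
  have hDs : ∀ s ∈ Icc t t', q s - qbar s = q t - qbar t := fun s hs =>
    le_antisymm (hD ▸ hmono (hI' s hs) (hI' _ htI') hs.2) (hmono (hI' _ htI) (hI' s hs) hs.1)
  have hqt : q t < q t' := lt_of_le_of_ne (hq.2 (hI _ htI) (hI _ htI') htt.le) hqne
  set c := q t with hc
  have hc0 : 0 ≤ c := hq.1 t (hI _ htI)
  set A : Set ℝ := {s ∈ Icc t t' | c < q s} with hA
  have hAne : A.Nonempty := ⟨t', htI', hqt⟩
  have hAbdd : BddBelow A := ⟨t, fun s hs => hs.1.1⟩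
  set s₀ := sInf A with hs₀
  have hts₀ : t ≤ s₀ := le_csInf hAne fun s hs => hs.1.1
  have hs₀t' : s₀ ≤ t' := csInf_le hAbdd ⟨htI', hqt⟩
  have hs₀I : s₀ ∈ Icc a b := hI _ ⟨hts₀, hs₀t'⟩
  have hflat : ∀ r, t ≤ r → r < s₀ → q r = c := by
    intro r hr hr'
    refine le_antisymm ?_ (hq.2 (hI _ htI) (hI r ⟨hr, hr'.le.trans hs₀t'⟩) hr)
    by_contra! hlt
    exact absurd (csInf_le hAbdd (show r ∈ A from ⟨⟨hr, hr'.le.trans hs₀t'⟩, hlt⟩)) (not_le.2 hr')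
  -- With a constant gap, mimicking `s` raises the signaled quality by exactly `q s - c`; incentive
  -- compatibility makes this at most the extra cost.
  have hIC : ∀ s ∈ A, ∀ r ∈ Icc t t', q r = c → q s - c ≤ C (q s) r - C c r := by
    intro s hs r hr hrc
    have e1 := hic r (hI r hr) s (hI s hs.1)
    have e2 := hDs s hs.1
    have e3 := hDs r hr
    rw [profit, hrc] at e1
    rw [hrc] at e3
    linarith
  have hslope : ∀ s ∈ A, q s - c ≤ C (q s) s₀ - C c s₀ := by
    intro s hs
    rcases hts₀.eq_or_lt with heq | hlt
    · exact heq ▸ hIC s hs t htI rfl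
    · have hsub : Ioo t s₀ ⊆ Icc a b := fun r hr => hI r ⟨hr.1.le, hr.2.le.trans hs₀t'⟩
      have hcont : ContinuousWithinAt (fun r => C (q s) r - C c r) (Ioo t s₀) s₀ :=
        (((hC.hasDeriv_t (hq.1 s (hI s hs.1)) hs₀I).sub
          (hC.hasDeriv_t hc0 hs₀I)).mono hsub).continuousWithinAt
      have : (nhdsWithin s₀ (Ioo t s₀)).NeBot := right_nhdsWithin_Ioo_neBot hlt
      refine ge_of_tendsto hcont ?_
      filter_upwards [self_mem_nhdsWithin] with r hr
      exact hIC s hs r ⟨hr.1.le, hr.2.le.trans hs₀t'⟩ (hflat r hr.1.le hr.2)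
  have hs₀b : s₀ < b := hs₀t'.trans_lt ht'
  set s₁ := (s₀ + b) / 2 with hs₁
  have hlow : ∀ s ∈ Icc a b, s < s₀ → q s ≤ c := by
    intro s hs hlt
    rcases le_total t s with h' | h'
    · exact (hflat s h' hlt).le
    · exact hq.2 hs (hI _ htI) h'
  have hhigh : ∀ s ∈ Ioo s₀ s₁, c < q s ∧ q s - c ≤ C (q s) s₀ - C c s₀ := by
    intro s hs
    obtain ⟨r, hr, hrs⟩ := exists_lt_of_csInf_lt hAne hs.1
    have hrq : q r ≤ q s := hq.2 (hI r hr.1)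
      ⟨hs₀I.1.trans hs.1.le, by linarith [hs.2]⟩ hrs.le
    exact ⟨hr.2.trans_le hrq, hC.sub_le_sub_of_le hab hc0 hr.2 hrq hs₀I (hslope r hr)⟩
  have has₀ : a < s₀ := ht.trans_le hts₀
  -- The perturbation needs a positive level, as `C_qθ` vanishes at quality zero. If `c = 0`, an
  -- average marginal cost of at least one forces `q` to jump above some `x > 0` with `C_q(x, s₀) <
  -- 1`, and `x` serves as the level.
  rcases hc0.eq_or_lt with hz | hpos
  · obtain ⟨x, hx, hx1⟩ := hC.exists_costQ_add_lt_one hab le_rfl hs₀I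
      (by rw [hC.costQ_zero s₀ hs₀I]; exact one_pos)
    rw [zero_add] at hx1
    have hCx := hC.sub_le_costQ_mul hab le_rfl hx.le hs₀I
    rw [hC.cost_zero s₀ hs₀I, sub_zero, sub_zero] at hCx
    refine h.false_of_le_cost_sub hC hab hF hw hw1 hS hne hx has₀ (by linarith) (by linarith)
      (s₁ := s₁) (fun s hs hlt => ((hlow s hs hlt).trans_eq hz.symm).trans hx.le) fun s hs => ?_
    obtain ⟨e1, e2⟩ := hhigh s hs
    rw [← hz, hC.cost_zero s₀ hs₀I, sub_zero, sub_zero] at e2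
    rw [← hz] at e1
    refine ⟨?_, by nlinarith⟩
    by_contra! hle
    have e3 := hC.sub_le_costQ_mul hab le_rfl e1.le hs₀I
    have e4 := hC.costQ_mono hab e1.le hle hs₀I
    rw [hC.cost_zero s₀ hs₀I, sub_zero, sub_zero] at e3
    nlinarith
  · exact h.false_of_le_cost_sub hC hab hF hw hw1 hS hne hpos has₀ (by linarith) (by linarith)
      hlow hhigh

/-- At a solution of the relaxed problem, signaled and actual qualities do not coincide. -/
lemma SolvesRelaxed.not_forall_sub_eq_zero (h : SolvesRelaxed a b C F w q)
    (hS : IsStrictlySubmodular a b C) (hne : ¬ ∀ᵐ t ∂F, w t = 1)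
    (hic : OnPathIC a b C q qbar) : ¬ ∀ t ∈ Ioo a b, q t - qbar t = 0 := by
  intro h0
  refine h.not_forall_eq_const hC hab hF hw hw1 hS (q ((a + b) / 2)) fun t ht => ?_
  have hm : (a + b) / 2 ∈ Ioo a b := ⟨by linarith, by linarith⟩
  rcases lt_trichotomy t ((a + b) / 2) with hlt | heq | hgt
  · exact h.quality_eq_of_sub_eq hC hab hF hw hw1 hS hne hic ht.1 hlt hm.2
      ((h0 t ht).trans (h0 _ hm).symm)
  · rw [heq]
  · exact (h.quality_eq_of_sub_eq hC hab hF hw hw1 hS hne hic hm.1 hgt ht.2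
      ((h0 _ hm).trans (h0 t ht).symm)).symm

end Slackness

/-! ### Equivalence of the three problems. -/

section Equivalence

variable {a b : ℝ} {C : ℝ → ℝ → ℝ} {F : Measure ℝ} [IsProbabilityMeasure F]
  [NullSingletonClass F] {w q : ℝ → ℝ}
variable (hC : IsCost a b C) (hab : a < b) (hF : F.support = Icc a b)
include hC hab hF

/-- A relaxed feasible pair with marginal costs at most one is implementable and satisfies
majorization. -/
lemma IsRelaxedFeasible.isImplementable {P : ℝ → ℝ} (h : IsRelaxedFeasible a b C F q P)
    (hle : ∀ t ∈ Ico a b, costQ C (q t) t ≤ 1) :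
    IsImplementable a b C F q (fun t => P t + C (q t) t) ∧
      IsMajFeasible a b C F q (fun t => P t + C (q t) t) := by
  have hq := h.allocation
  have hprof : profit C q (fun t => P t + C (q t) t) = P := by
    ext t; simp [profit]
  have henv : Envelope a b C q (profit C q fun t => P t + C (q t) t) := by
    rw [hprof]; exact h.envelope
  have hpart : ∀ t ∈ Icc a b, 0 ≤ profit C q (fun t => P t + C (q t) t) t := by
    rw [hprof]; exact h.participation
  have hic := onPathIC_of_envelope hC hab hq henv
  have hqb := hic.signaled_mono hC hq
  have hqbi := integrable_of_monotoneOn (F := F) hF hqb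
  have hCi := hC.integrable_cost hab hF hq
  have hint : ∫ t, (P t + C (q t) t) ∂F = ∫ t, q t ∂F := by
    have hPi : Integrable P F := (hqbi.sub hCi).congr (ae_of_all _ fun t => by simp)
    rw [integral_add hPi hCi, h.resource, integral_sub (integrable_of_monotoneOn hF hq.2) hCi]
    ring
  have hD := hic.monotoneOn_sub hC hab hq hle
  refine ⟨?_, hq, hqb, henv, hpart,
    majorizes_of_monotoneOn_sub hab hF (integrable_of_monotoneOn hF hq.2) hqbi hD hint⟩
  obtain ⟨m, hm0, hm, -⟩ := exists_generic_price hC hic hpart hab hq hF hD hint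
  obtain ⟨π, hπ, p, heq, -⟩ := exists_equilibrium_of_mem_uIcc hC hab hq hic hpart hF hm0 hm hint
  exact ⟨ℝ ⊕ Unit, inferInstance, π, hπ, p, heq⟩

variable (hw : AntitoneOn w (Icc a b)) (hw1 : ∫ t, w t ∂F = 1)
include hw hw1

/-- Maximizing welfare over a class of pairs between the implementable or majorization-feasible
ones and the relaxed feasible ones is the same as solving the relaxed problem. -/
lemma exists_optimal_iff_solvesRelaxed (R : (ℝ → ℝ) → (ℝ → ℝ) → Prop)
    (hR : ∀ q qbar, R q qbar → IsRelaxedFeasible a b C F q (profit C q qbar))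
    (hR' : ∀ q P, IsRelaxedFeasible a b C F q P → (∀ t ∈ Ico a b, costQ C (q t) t ≤ 1) →
      R q fun t => P t + C (q t) t) :
    (∃ qbar, R q qbar ∧ ∀ q' qbar', R q' qbar' →
      welfare F w (profit C q' qbar') ≤ welfare F w (profit C q qbar)) ↔
      SolvesRelaxed a b C F w q := by
  have hprof : ∀ q P : ℝ → ℝ, profit C q (fun t => P t + C (q t) t) = P := fun q P => by
    ext t; simp [profit]
  constructor
  · rintro ⟨qbar, hqb, hopt⟩
    refine ⟨profit C q qbar, hR _ _ hqb, fun q' P' h' => ?_⟩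
    -- A relaxed competitor need not belong to `R`, but its capped version does and is at least as
    -- good.
    obtain ⟨P'', hP'', hle⟩ := h'.exists_ceilingQuality hC hab hF hw hw1
    have := hopt _ _ (hR' _ _ hP'' fun t ht =>
      (ceilingQuality_mem hC hab h'.allocation (Ico_subset_Icc_self ht)).2)
    rw [hprof] at this
    exact hle.trans this
  · intro h
    have hle := fun t ht => h.costQ_le_one hC hab hF hw hw1 (t := t) ht
    obtain ⟨P, hP, hopt⟩ := h
    refine ⟨_, hR' q P hP hle, fun q' qbar' h' => ?_⟩
    rw [hprof]
    exact hopt _ _ (hR _ _ h')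

lemma isParetoOptimal_iff_solvesRelaxed :
    IsParetoOptimal a b C F w q ↔ SolvesRelaxed a b C F w q :=
  exists_optimal_iff_solvesRelaxed hC hab hF hw hw1 (IsImplementable a b C F)
    (fun _ _ ⟨_, _, _, _, _, h⟩ => h.isRelaxedFeasible hC hab hF)
    fun _ _ h hle => (h.isImplementable hC hab hF hle).1

lemma solvesMaj_iff_solvesRelaxed :
    SolvesMaj a b C F w q ↔ SolvesRelaxed a b C F w q :=
  exists_optimal_iff_solvesRelaxed hC hab hF hw hw1 (IsMajFeasible a b C F)
    (fun _ _ h => h.isRelaxedFeasible hC hab hF)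
    fun _ _ h hle => (h.isImplementable hC hab hF hle).2

end Equivalence

end RatingDesign

theorem mainTheorem6 (a b : ℝ) (hab : a < b) (C : ℝ → ℝ → ℝ) (hC : RatingDesign.IsCost a b C)
    (F : Measure ℝ) [IsProbabilityMeasure F] (hF0 : ∀ t, F {t} = 0) (hF : F.support = Icc a b)
    (w : ℝ → ℝ) (hw : AntitoneOn w (Icc a b)) (hw1 : ∫ t, w t ∂F = 1) :
    (∀ q : ℝ → ℝ,
      (RatingDesign.IsParetoOptimal a b C F w q ↔ RatingDesign.SolvesRelaxed a b C F w q) ∧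
      (RatingDesign.SolvesMaj a b C F w q ↔ RatingDesign.SolvesRelaxed a b C F w q)) ∧
    (RatingDesign.IsStrictlySubmodular a b C → (¬ ∀ᵐ t ∂F, w t = 1) →
      ∀ q : ℝ → ℝ, RatingDesign.IsParetoOptimal a b C F w q →
        ∀ qbar : ℝ → ℝ, RatingDesign.IsImplementable a b C F q qbar →
          RatingDesign.Majorizes a b F q qbar ∧
          (∀ t ∈ Ioo a b, ∫ s in Icc a t, q s ∂F < ∫ s in Icc a t, qbar s ∂F) ∧
          ∃ (π : Kernel ℝ (ℝ ⊕ Unit)) (_ : IsMarkovKernel π) (p : ℝ ⊕ Unit → ℝ),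
            RatingDesign.IsEquilibrium a b C F π p q qbar ∧
            RatingDesign.IsFullMixing a b π p q) := by
  have : NullSingletonClass F := ⟨hF0⟩
  refine ⟨fun q => ⟨RatingDesign.isParetoOptimal_iff_solvesRelaxed hC hab hF hw hw1,
    RatingDesign.solvesMaj_iff_solvesRelaxed hC hab hF hw hw1⟩, ?_⟩
  rintro hS hne q hopt qbar ⟨S, _, π₀, _, p₀, heq⟩
  have h := (RatingDesign.isParetoOptimal_iff_solvesRelaxed hC hab hF hw hw1).1 hopt
  have hq := heq.allocation
  have hic := heq.onPathIC
  have hqb := hic.signaled_mono hC hq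
  have hqi := RatingDesign.integrable_of_monotoneOn (F := F) hF hq.2
  have hqbi := RatingDesign.integrable_of_monotoneOn (F := F) hF hqb
  have hint := heq.integral_signaled hF
  have hD := hic.monotoneOn_sub hC hab hq fun s hs => h.costQ_le_one hC hab hF hw hw1 hs
  have hD0 : ∫ t, (q t - qbar t) ∂F = 0 := by rw [integral_sub hqi hqbi, hint, sub_self]
  have hnz := h.not_forall_sub_eq_zero hC hab hF hw hw1 hS hne hic
  have hneg : ∀ t ∈ Ioo a b, ∫ s in Icc a t, (q s - qbar s) ∂F < 0 := by
    intro t ht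
    by_contra! hge
    exact hnz (RatingDesign.eqOn_zero_of_setIntegral_nonneg hF hD (hqi.sub hqbi) hD0 ht hge)
  refine ⟨RatingDesign.majorizes_of_monotoneOn_sub hab hF hqi hqbi hD hint, fun t ht => ?_, ?_⟩
  · have := hneg t ht
    rw [integral_sub hqi.integrableOn hqbi.integrableOn] at this
    linarith
  · obtain ⟨m, hm0, hm, hfix⟩ :=
      RatingDesign.exists_generic_price hC hic heq.participation hab hq hF hD hint
    obtain ⟨π, hπ, p, he, hfull⟩ := RatingDesign.exists_equilibrium_of_mem_uIcc hC hab hq hic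
      heq.participation hF hm0 hm hint
    refine ⟨π, hπ, p, he, hfull (hfix ?_)⟩
    -- Rigidity of the gap covers interior types only, so `a` is excluded separately: a zero gap at
    -- `a` would make the gap nonnegative on `[a, b)`, contrary to interior slackness.
    have ha : q a ≠ qbar a := by
      intro hqa
      have hm : (a + b) / 2 ∈ Ioo a b := ⟨by linarith, by linarith⟩
      refine absurd (hneg _ hm) (not_lt.2 (setIntegral_nonneg measurableSet_Icc fun s hs => ?_))
      have := hD (left_mem_Ico.2 hab) ⟨hs.1, hs.2.trans_lt hm.2⟩ hs.1
      dsimp only at this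
      linarith
    have hmain : ∀ t ∈ Ico a b, ∀ t' ∈ Ico a b, t ≤ t' → q t = qbar t → q t' = qbar t' →
        qbar t = qbar t' := by
      intro t ht t' ht' htt e e'
      rcases htt.eq_or_lt with rfl | hlt
      · rfl
      · have hat : a < t := lt_of_le_of_ne ht.1 fun hh => ha (by rw [hh, e])
        exact hic.signaled_eq (Ico_subset_Icc_self ht) (Ico_subset_Icc_self ht')
          (h.quality_eq_of_sub_eq hC hab hF hw hw1 hS hne hic hat hlt ht'.2 (by rw [e, e']; ring))
    intro t ht t' ht' e e'
    rcases le_total t t' with h' | h'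
    · exact hmain t ht t' ht' h' e e'
    · exact (hmain t' ht' t ht h' e' e).symm
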